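/- All systems are finite-dimensional. For density matrices put $F(\rho,\sigma)=\mathrm{Tr}\sqrt{\sqrt\sigma\rho\sqrt\sigma}$. The quantum Fisher information (QFI) at $\theta$ of a one-parameter family $\rho_\theta$ is $$I_\theta=\limsup_{\delta\to0}\frac{8\,[1-F(\rho_\theta,\rho_{\theta+\delta})]}{\delta^2},$$ which is the limit whenever the limit exists. For a channel $\mathcal E$ on a $d$-dimensional input, $\rho_{\mathcal E}=(\mathcal I\otimes\mathcal E)(\Phi)$ is its Choi matrix, where $\Phi=|\Phi\rangle\langle\Phi|$ and $|\Phi\rangle=d^{-1/2}\sum_j|jj\rangle$. An $n$-probing adaptive protocol $\mathcal P$ starts from an arbitrary joint register state. It then $n$ times sends one system of the registers through the box $\mathcal E_\theta$, each time followed by an arbitrary $\theta$-independent completely positive trace-preserving map on all systems held (registers of arbitrary finite dimension, possibly changing at each step). Its output is $\rho^n_{\mathcal P}(\theta)$. The adaptive QFI $\bar I^n_\theta$ is the supremum over all $\mathcal P$ of the QFI of $\rho^n_{\mathcal P}(\theta)$. Let $X|j\rangle=|j+1\rangle$ and $Z|j\rangle=e^{2\pi i j/d}|j\rangle$ ($j\in\mathbb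 Z/d$), and let $P_k=X^sZ^t$, $k=(s,t)$, be the $d^2$ generalized Pauli operators. For $\boldsymbol p=(p_k)$ let $\mathcal E_{\boldsymbol p}(\rho)=\sum_kp_kP_k\rho P_k^\dagger$, and let $\beta_k=(I\otimes P_k)\Phi(I\otimes P_k)^\dagger$. **(A)** Let $\mathcal E_p$ be one of: the qubit depolarizing channel (Pauli channel with probabilities $1-p,p/3,p/3,p/3$ of $I,X,Y,Z$); the qubit dephasing channel (probabilities $1-p,0,0,p$); the qudit erasure channel $\rho\mapsto(1-p)\rho+p\,\mathrm{Tr}(\rho)|e\rangle\langle e|$ for any $d\ge1$, with $|e\rangle$ orthogonal to the qudit space. Then for all $0<p<1$: 1. the family of Choi matrices has QFI $B(p)=1/[p(1-p)]$, as a limit; 2. for all $n\ge 0$, $\bar I^n_p=n/[p(1-p)]$, and this value is attained, as a limit, by the non-adaptive protocol that sends halves of independent copies of $\Phi$ through the box and stores the outputs; 3. for every $n\ge1$, every adaptive protocol and every measurement and real-valued estimator (a POVM on $\mathbb R$) that is unbiased for all parameter values near $p$, the variance at $p$ satisfies $\mathrm{Var}(p)\ge p(1-p)/n$; 4. the bound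 is achieved asymptotically by that non-adaptive protocol: there are measurements and estimators, one for each $n$ and not depending on $p$, that for every $0<p<1$ are unbiased for $n\ge1$ and satisfy $n\,\mathrm{Var}(p)\to p(1-p)$ as $n\to\infty$. **(B)** For every $d\ge1$: $\rho_{\mathcal E_{\boldsymbol p}}=\sum_kp_k\beta_k$ and $\beta_k\beta_l=\delta_{kl}\beta_k$. For probability distributions $\boldsymbol p,\boldsymbol q$, $$F(\rho_{\mathcal E_{\boldsymbol p}},\rho_{\mathcal E_{\boldsymbol q}})=\sum_k\sqrt{p_kq_k}.$$ Moreover, as $\boldsymbol{\delta}\to0$ with $\sum_k\delta_k=0$ and $\delta_k=0$ whenever $p_k=0$, $$F(\rho_{\mathcal E_{\boldsymbol p}},\rho_{\mathcal E_{\boldsymbol p+\boldsymbol\delta}})=1-\frac18\sum_{k:\,p_k>0}\frac{\delta_k^2}{p_k}+o(\|\boldsymbol\delta\|^2).$$ **(C)** For the qudit erasure channels $\mathcal E_\pi$ ($d\ge1$), $\rho_{\mathcal E_\pi}=(1-\pi)\Phi+\pi\frac{I}{d}\otimes|e\rangle\langle e|$ (with $\Phi$ embedded in the space enlarged by $|e\rangle$),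 and for $\pi,\pi'\in[0,1]$ $$F(\rho_{\mathcal E_\pi},\rho_{\mathcal E_{\pi'}})=\sqrt{(1-\pi)(1-\pi')}+\sqrt{\pi\pi'}.$$ -/

import Mathlib

open Filter Topology MeasureTheory ProbabilityTheory
open scoped ENNReal MatrixOrder ComplexOrder Kronecker

noncomputable section

namespace NoiseEstimation

/-! ### States, channels, fidelity -/

/-- Operators on the finite-dimensional Hilbert space with orthonormal basis indexed by `a`. -/
abbrev Op (a : Type) : Type := Matrix a a ℂ

/-- Density operators. -/
def IsDensity {a : Type} [Fintype a] (ρ : Op a) : Prop :=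
  ρ.PosSemidef ∧ ρ.trace = 1

/-- The map `id_R ⊗ E`, applying `E` to the second tensor factor. -/
def ampliate (R : Type) {a b : Type} (E : Op a →ₗ[ℂ] Op b) : Op (R × a) →ₗ[ℂ] Op (R × b) where
  toFun X := Matrix.of fun x y => E (Matrix.of fun u v => X (x.1, u) (y.1, v)) x.2 y.2
  map_add' X Y := by
    ext x y
    have h := map_add E (Matrix.of fun u v => X (x.1, u) (y.1, v))
      (Matrix.of fun u v => Y (x.1, u) (y.1, v))
    exact congrFun (congrFun h x.2) y.2
  map_smul' c X := by
    ext x y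
    have h := map_smul E c (Matrix.of fun u v => X (x.1, u) (y.1, v))
    exact congrFun (congrFun h x.2) y.2

/-- Quantum channels: completely positive and trace-preserving linear maps. -/
structure IsChannel {a b : Type} [Fintype a] [Fintype b] (E : Op a →ₗ[ℂ] Op b) : Prop where
  completelyPositive : ∀ (k : ℕ) (X : Op (Fin k × a)),
    X.PosSemidef → (ampliate (Fin k) E X).PosSemidef
  tracePreserving : ∀ X : Op a, (E X).trace = X.trace

/-- The fidelity `F(ρ, σ) = Tr √(√σ ρ √σ)` (root fidelity). -/
def fidelity {a : Type} [Fintype a] [DecidableEq a] (ρ σ : Op a) : ℝ :=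
  (CFC.sqrt (CFC.sqrt σ * ρ * CFC.sqrt σ)).trace.re

/-- The vector `d^{-1/2} ∑ⱼ |jj⟩`. -/
def bellVector (a : Type) [Fintype a] [DecidableEq a] : a × a → ℂ :=
  fun x => if x.1 = x.2 then (((Real.sqrt (Fintype.card a))⁻¹ : ℝ) : ℂ) else 0

/-- The maximally entangled state `Φ = |Φ⟩⟨Φ|`. -/
def bell (a : Type) [Fintype a] [DecidableEq a] : Op (a × a) :=
  Matrix.vecMulVec (bellVector a) (star (bellVector a))

/-- The Choi matrix `ρ_E = (id ⊗ E)(Φ)`. -/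
def choi {a b : Type} [Fintype a] [DecidableEq a] (E : Op a →ₗ[ℂ] Op b) : Op (a × b) :=
  ampliate a E (bell a)

/-! ### Quantum Fisher information -/

/-- The quotient `8 [1 - F(ρ_θ, ρ_{θ+δ})] / δ²`. -/
def fisherQuotient {a : Type} [Fintype a] [DecidableEq a] (ρ : ℝ → Op a) (θ δ : ℝ) : ℝ :=
  8 * (1 - fidelity (ρ θ) (ρ (θ + δ))) / δ ^ 2

/-- The family `ρ` has quantum Fisher information `I` at `θ`, as a genuine limit `δ → 0`. -/
def HasQFI {a : Type} [Fintype a] [DecidableEq a] (ρ : ℝ → Op a) (θ I : ℝ) : Prop :=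
  Tendsto (fisherQuotient ρ θ) (𝓝[≠] 0) (𝓝 I)

/-- The quantum Fisher information of the family `ρ` at `θ`, for every family: it is the upper
limit as `δ → 0`, hence the limit whenever that exists. -/
def qfi {a : Type} [Fintype a] [DecidableEq a] (ρ : ℝ → Op a) (θ : ℝ) : ℝ≥0∞ :=
  limsup (fun δ => ENNReal.ofReal (fisherQuotient ρ θ δ)) (𝓝[≠] 0)

/-! ### Adaptive protocols -/

/-- An adaptive protocol probing a box with input system `a` and output system `b`.
Before the `(i+1)`-th probing the two parties jointly hold registers of the form
`reg i ⊗ a`, where `a` is the system picked as next input; the `(i+1)`-th probing turns this into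
`reg i ⊗ b`; the joint operation `op i`, an arbitrary channel on everything the parties hold,
then gives `reg (i+1) ⊗ a`. The register dimensions are arbitrary and may change at each step.
The first `n` steps make up an `n`-probing protocol, whose output is `state E n`. -/
structure AdaptiveProtocol (a b : Type) [Fintype a] [Fintype b] where
  reg : ℕ → Type
  fintypeReg : ∀ i, Fintype (reg i)
  decEqReg : ∀ i, DecidableEq (reg i)
  init : Op (reg 0 × a)
  init_isDensity : IsDensity init
  op : ∀ i, Op (reg i × b) →ₗ[ℂ] Op (reg (i + 1) × a)
  op_isChannel : ∀ i, IsChannel (op i)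

attribute [instance] AdaptiveProtocol.fintypeReg AdaptiveProtocol.decEqReg

/-- The joint register state after `n` probings of the box `E`. -/
def AdaptiveProtocol.state {a b : Type} [Fintype a] [Fintype b] (P : AdaptiveProtocol a b)
    (E : Op a →ₗ[ℂ] Op b) : (n : ℕ) → Op (P.reg n × a)
  | 0 => P.init
  | n + 1 => P.op n (ampliate (P.reg n) E (P.state E n))

/-- The adaptive QFI for `n` probings: the supremum over all adaptive protocols. -/
def adaptiveQFI {a b : Type} [Fintype a] [DecidableEq a] [Fintype b]
    (E : ℝ → (Op a →ₗ[ℂ] Op b)) (n : ℕ) (θ : ℝ) : ℝ≥0∞ :=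
  ⨆ P : AdaptiveProtocol a b, qfi (fun t => P.state (E t) n) θ

/-! ### Measurements and estimators -/

/-- A positive operator valued measure on `ℝ`: a measurement together with the (possibly
randomised) processing of its outcome into a real estimate. -/
structure EstimatorPOVM (s : Type) [Fintype s] [DecidableEq s] where
  effect : Set ℝ → Op s
  posSemidef : ∀ A, MeasurableSet A → (effect A).PosSemidef
  univ : effect Set.univ = 1
  iUnion : ∀ A : ℕ → Set ℝ, (∀ i, MeasurableSet (A i)) → Pairwise (Function.onFun Disjoint A) →
    HasSum (fun i => effect (A i)) (effect (⋃ i, A i))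

theorem trace_mul_re_nonneg {s : Type} [Fintype s] [DecidableEq s] {ρ X : Op s}
    (hρ : ρ.PosSemidef) (hX : X.PosSemidef) : 0 ≤ (ρ * X).trace.re := by
  obtain ⟨B, rfl⟩ : ∃ B : Op s, X = B.conjTranspose * B :=
    CStarAlgebra.nonneg_iff_eq_star_mul_self.mp hX.nonneg
  have h : (ρ * (B.conjTranspose * B)).trace = (B * ρ * B.conjTranspose).trace := by
    rw [← Matrix.mul_assoc, Matrix.trace_mul_comm, ← Matrix.mul_assoc]
  rw [h]
  have := (hρ.mul_mul_conjTranspose_same B).trace_nonneg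
  exact (Complex.le_def.mp this).1

theorem EstimatorPOVM.hasSum_trace {s : Type} [Fintype s] [DecidableEq s] (M : EstimatorPOVM s)
    (ρ : Op s) (A : ℕ → Set ℝ) (hA : ∀ i, MeasurableSet (A i))
    (hd : Pairwise (Function.onFun Disjoint A)) :
    HasSum (fun i => (ρ * M.effect (A i)).trace.re) (ρ * M.effect (⋃ i, A i)).trace.re := by
  have hc : Continuous fun X : Op s => (ρ * X).trace.re := by fun_prop
  let f : Op s →+ ℝ :=
    { toFun := fun X => (ρ * X).trace.re
      map_zero' := by simp
      map_add' := fun X Y => by simp [Matrix.mul_add] }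
  exact (M.iUnion A hA hd).map f hc

theorem EstimatorPOVM.effect_empty {s : Type} [Fintype s] [DecidableEq s] (M : EstimatorPOVM s) :
    M.effect ∅ = 0 := by
  have h := M.iUnion (fun _ => ∅) (fun _ => .empty) (fun _ _ _ => by simp [Function.onFun])
  exact tendsto_nhds_unique tendsto_const_nhds h.summable.tendsto_atTop_zero

open Classical in
/-- The law `A ↦ Tr(ρ M(A))` of the estimate when the state `ρ` is measured
(the zero measure by convention if `ρ` is not positive semidefinite). -/
def EstimatorPOVM.law {s : Type} [Fintype s] [DecidableEq s] (M : EstimatorPOVM s) (ρ : Op s) :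
    Measure ℝ :=
  if hρ : ρ.PosSemidef then
    Measure.ofMeasurable (fun A _ => ENNReal.ofReal (ρ * M.effect A).trace.re)
      (by simp [M.effect_empty])
      (fun A hA hd => by
        rw [← (M.hasSum_trace ρ A hA hd).tsum_eq]
        exact ENNReal.ofReal_tsum_of_nonneg
          (fun i => trace_mul_re_nonneg hρ (M.posSemidef _ (hA i)))
          (M.hasSum_trace ρ A hA hd).summable)
  else 0

/-- Local unbiasedness: the mean of the estimate equals the parameter, near the true value `p`. -/
def LocallyUnbiased {s : Type} [Fintype s] [DecidableEq s] (M : EstimatorPOVM s) (ρ : ℝ → Op s)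
    (p : ℝ) : Prop :=
  ∀ᶠ q in 𝓝 p, Integrable (fun x => x) (M.law (ρ q)) ∧ ∫ x, x ∂(M.law (ρ q)) = q

/-- The variance of the estimate in the state `ρ`, possibly infinite. -/
def estimatorVariance {s : Type} [Fintype s] [DecidableEq s] (M : EstimatorPOVM s) (ρ : Op s) :
    ℝ≥0∞ :=
  evariance (fun x : ℝ => x) (M.law ρ)

/-! ### The entanglement-based non-adaptive protocol -/

theorem bell_posSemidef (a : Type) [Fintype a] [DecidableEq a] : (bell a).PosSemidef :=
  Matrix.posSemidef_vecMulVec_self_star _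

theorem bell_trace (a : Type) [Fintype a] [DecidableEq a] [Nonempty a] : (bell a).trace = 1 := by
  have h : ((Real.sqrt (Fintype.card a))⁻¹ : ℝ) * (Real.sqrt (Fintype.card a))⁻¹
      = ((Fintype.card a : ℝ))⁻¹ := by
    rw [← mul_inv, Real.mul_self_sqrt (by positivity)]
  have h' : (((Real.sqrt (Fintype.card a))⁻¹ : ℝ) : ℂ) * (((Real.sqrt (Fintype.card a))⁻¹ : ℝ) : ℂ)
      = ((Fintype.card a : ℂ))⁻¹ := by
    rw [← Complex.ofReal_mul, h]; simp
  have hd : (Fintype.card a : ℂ) ≠ 0 := by simp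
  simp only [bell, Matrix.trace, Matrix.diag_apply, Matrix.vecMulVec_apply, Pi.star_apply,
    bellVector, Fintype.sum_prod_type]
  simp only [RCLike.star_def]
  calc _ = ∑ x : a, ∑ y : a, (if x = y then ((Fintype.card a : ℂ))⁻¹ else 0) := by
        refine Finset.sum_congr rfl fun x _ => Finset.sum_congr rfl fun y _ => ?_
        split_ifs
        · rw [Complex.conj_ofReal, h']
        · simp
    _ = 1 := by simp [hd]

/-- The system on which the first `i` transmitted pairs (reference and output) are stored,
together with the reference half of the next maximally entangled pair. -/
abbrev BellReg (a b : Type) (i : ℕ) : Type := (Fin i → a × b) × a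

/-- Storage of the last transmitted pair. -/
def bellIndex {a b : Type} (i : ℕ) (z : BellReg a b (i + 1) × a) : (BellReg a b i × b) × (a × a) :=
  (((Fin.init z.1.1, (z.1.1 (Fin.last i)).1), (z.1.1 (Fin.last i)).2), (z.1.2, z.2))

/-- Store the output next to its reference, and prepare a fresh maximally entangled pair. -/
def bellOp (a b : Type) [Fintype a] [DecidableEq a] (i : ℕ) :
    Op (BellReg a b i × b) →ₗ[ℂ] Op (BellReg a b (i + 1) × a) where
  toFun X := (X ⊗ₖ bell a).submatrix (bellIndex i) (bellIndex i)
  map_add' X Y := by rw [Matrix.add_kronecker]; rfl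
  map_smul' c X := by rw [Matrix.smul_kronecker]; rfl

theorem bellIndex_bijective {a b : Type} (i : ℕ) :
    Function.Bijective (bellIndex (a := a) (b := b) i) := by
  refine Function.bijective_iff_has_inverse.mpr
    ⟨fun w => ((Fin.snoc (α := fun _ => a × b) w.1.1.1 (w.1.1.2, w.1.2), w.2.1), w.2.2), ?_, ?_⟩
  · rintro ⟨⟨h, r⟩, t⟩
    simp [bellIndex]
  · rintro ⟨⟨⟨h, r⟩, t⟩, u, v⟩
    simp [bellIndex]

theorem bellOp_isChannel (a b : Type) [Fintype a] [DecidableEq a] [Nonempty a] [Fintype b]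
    (i : ℕ) : IsChannel (bellOp a b i) where
  completelyPositive k X hX := by
    classical
    have h : ampliate (Fin k) (bellOp a b i) X = (X ⊗ₖ bell a).submatrix
        (fun z => ((z.1, (bellIndex i z.2).1), (bellIndex i z.2).2))
        (fun z => ((z.1, (bellIndex i z.2).1), (bellIndex i z.2).2)) := by
      ext x y
      rfl
    rw [h]
    exact (hX.kronecker (bell_posSemidef a)).submatrix _
  tracePreserving X := by
    have h : (bellOp a b i X).trace = (X ⊗ₖ bell a).trace := by
      simp only [Matrix.trace, Matrix.diag_apply]
      exact (bellIndex_bijective i).sum_comp fun w => (X ⊗ₖ bell a) w w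
    rw [h, Matrix.trace_kronecker, bell_trace, mul_one]

/-- The non-adaptive protocol that sends halves of independent maximally entangled pairs through
the box and stores the outputs. After `n` probings it has prepared `n` copies of the Choi matrix
of the box (and one further, unused pair). -/
def bellProtocol (a b : Type) [Fintype a] [DecidableEq a] [Nonempty a] [Fintype b]
    [DecidableEq b] : AdaptiveProtocol a b where
  reg i := BellReg a b i
  fintypeReg i := inferInstance
  decEqReg i := inferInstance
  init := (bell a).submatrix (fun z => (z.1.2, z.2)) (fun z => (z.1.2, z.2))
  init_isDensity := by
    refine ⟨(bell_posSemidef a).submatrix _, ?_⟩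
    rw [← bell_trace a]
    simp only [Matrix.trace, Matrix.diag_apply]
    have hb : Function.Bijective (fun z : BellReg a b 0 × a => (z.1.2, z.2)) := by
      refine Function.bijective_iff_has_inverse.mpr
        ⟨fun w => ((Fin.elim0, w.1), w.2), ?_, fun w => rfl⟩
      rintro ⟨⟨h, r⟩, t⟩
      simp only [Prod.mk.injEq, and_true]
      exact Subsingleton.elim _ _
    exact hb.sum_comp fun w => bell a w w
  op i := bellOp a b i
  op_isChannel i := bellOp_isChannel a b i

/-! ### The channels -/

/-- The shift operator `X |j⟩ = |j+1⟩`. -/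
def shiftOp (d : ℕ) : Op (ZMod d) := Matrix.of fun i j => if i = j + 1 then 1 else 0

/-- The clock operator `Z |j⟩ = ω^j |j⟩`, `ω = exp(2πi/d)`. -/
def clockOp (d : ℕ) : Op (ZMod d) :=
  Matrix.diagonal fun j => Complex.exp (2 * Real.pi * Complex.I * (j.val : ℂ) / (d : ℂ))

/-- The `d²` generalized Pauli operators `X^s Z^t`. For `d = 2` the indices `(0,0)`, `(1,0)`,
`(1,1)`, `(0,1)` give `I`, `X`, `XZ = -iY`, `Z`. -/
def pauliOp (d : ℕ) [NeZero d] (k : ZMod d × ZMod d) : Op (ZMod d) :=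
  shiftOp d ^ k.1.val * clockOp d ^ k.2.val

/-- The conjugation `ρ ↦ K ρ K†` as a linear map. -/
def conjMap {a b : Type} [Fintype a] (K : Matrix b a ℂ) : Op a →ₗ[ℂ] Op b where
  toFun ρ := K * ρ * K.conjTranspose
  map_add' X Y := by rw [Matrix.mul_add, Matrix.add_mul]
  map_smul' c X := by simp

/-- The qudit generalized Pauli channel `ρ ↦ ∑ₖ pₖ Pₖ ρ Pₖ†`. -/
def pauliChannel (d : ℕ) [NeZero d] (p : ZMod d × ZMod d → ℝ) :
    Op (ZMod d) →ₗ[ℂ] Op (ZMod d) :=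
  ∑ k, (p k : ℂ) • conjMap (pauliOp d k)

/-- The generalized Bell projectors `βₖ = (I ⊗ Pₖ) Φ (I ⊗ Pₖ)†`. -/
def bellProjector (d : ℕ) [NeZero d] (k : ZMod d × ZMod d) : Op (ZMod d × ZMod d) :=
  conjMap ((1 : Op (ZMod d)) ⊗ₖ pauliOp d k) (bell (ZMod d))

/-- The qubit depolarizing channel, with probabilities `{1-p, p/3, p/3, p/3}` of `I, X, Y, Z`. -/
def depolarizing (p : ℝ) : Op (ZMod 2) →ₗ[ℂ] Op (ZMod 2) :=
  pauliChannel 2 fun k => if k = 0 then 1 - p else p / 3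

/-- The qubit dephasing channel, with probabilities `{1-p, 0, 0, p}` of `I, X, Y, Z`. -/
def dephasing (p : ℝ) : Op (ZMod 2) →ₗ[ℂ] Op (ZMod 2) :=
  pauliChannel 2 fun k => if k = 0 then 1 - p else if k = (0, 1) then p else 0

/-- The isometric embedding of the qudit space into the space enlarged by the erasure state. -/
def embedOp (d : ℕ) : Matrix (Option (ZMod d)) (ZMod d) ℂ :=
  Matrix.of fun i j => if i = some j then 1 else 0

/-- The projector `|e⟩⟨e|` onto the erasure state `e = none`. -/
def erasureState (d : ℕ) : Op (Option (ZMod d)) := Matrix.single none none 1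

/-- The qudit erasure channel `ρ ↦ (1-π) ρ + π Tr(ρ) |e⟩⟨e|`. -/
def erasure (d : ℕ) [NeZero d] (π : ℝ) : Op (ZMod d) →ₗ[ℂ] Op (Option (ZMod d)) :=
  ((1 - π : ℝ) : ℂ) • conjMap (embedOp d) +
    (π : ℂ) • (Matrix.traceLinearMap (ZMod d) ℂ ℂ).smulRight (erasureState d)

/-! ### The claim for a one-parameter family of channels -/

/-- The family `E p`, `0 < p < 1`, obeys the standard quantum limit `p(1-p)/n` under adaptive
estimation. -/
structure ObeysAdaptiveLimit {a b : Type} [Fintype a] [DecidableEq a] [Nonempty a] [Fintype b]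
    [DecidableEq b] (E : ℝ → (Op a →ₗ[ℂ] Op b)) : Prop where
  /-- The QFI of the Choi matrix is `1/[p(1-p)]`. -/
  choi_qfi : ∀ p ∈ Set.Ioo (0 : ℝ) 1, HasQFI (fun q => choi (E q)) p (1 / (p * (1 - p)))
  /-- The adaptive QFI for `n` probings is `n/[p(1-p)]`. -/
  adaptive_qfi : ∀ p ∈ Set.Ioo (0 : ℝ) 1, ∀ n : ℕ,
    adaptiveQFI E n p = ENNReal.ofReal (n / (p * (1 - p)))
  /-- The supremum is attained by the entanglement-based non-adaptive protocol. -/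
  attained : ∀ p ∈ Set.Ioo (0 : ℝ) 1, ∀ n : ℕ,
    HasQFI (fun q => (bellProtocol a b).state (E q) n) p (n / (p * (1 - p)))
  /-- Every unbiased estimator of every adaptive protocol has variance at least `p(1-p)/n`. -/
  cramer_rao : ∀ p ∈ Set.Ioo (0 : ℝ) 1, ∀ n : ℕ, 1 ≤ n →
    ∀ (P : AdaptiveProtocol a b) (M : EstimatorPOVM (P.reg n × a)),
      LocallyUnbiased M (fun q => P.state (E q) n) p →
        ENNReal.ofReal (p * (1 - p) / n) ≤ estimatorVariance M (P.state (E p) n)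
  /-- The bound is achieved for large `n` by the entanglement-based non-adaptive protocol, with
  estimators that do not depend on the true value of `p`. -/
  achievable : ∃ M : ∀ n : ℕ, EstimatorPOVM ((bellProtocol a b).reg n × a),
    ∀ p ∈ Set.Ioo (0 : ℝ) 1,
      (∀ n : ℕ, 1 ≤ n →
        LocallyUnbiased (M n) (fun q => (bellProtocol a b).state (E q) n) p) ∧
      Tendsto (fun n : ℕ =>
          (n : ℝ≥0∞) * estimatorVariance (M n) ((bellProtocol a b).state (E p) n))
        atTop (𝓝 (ENNReal.ofReal (p * (1 - p))))

end NoiseEstimation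

end

open NoiseEstimation

/-!
All the channels in question have the form `(1 - q) A + q B` with two fixed channels `A` and `B`,
and everything follows from two facts about such mixtures.

*Simulation.* An adaptive protocol with `n` uses of the box is linear in each use, so its output is
`∑ₖ q ^ k (1 - q) ^ (n - k) τₖ`, where the positive operator `τₖ` of trace `n.choose k` does not
depend on `q` (`AdaptiveProtocol.state_eq_sum_component`). The parameter thus enters only through
`n` classical coin flips. The fidelity of two such outputs is at least the classical one,
`(√((1 - p)(1 - q)) + √(pq)) ^ n` (`AdaptiveProtocol.bernoulliFidelity_pow_le_fidelity`), which
bounds the quantum Fisher information by `n / (p (1 - p))`. This uses the lower bound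
`le_fidelity_of_forall_posDef` for the fidelity, an infimum over positive definite operators. In
the same way, the law of any estimator is a binomial mixture of fixed measures, and the classical
Cramér–Rao argument applies to it (`ofReal_le_estimatorVariance`): no quantum Cramér–Rao inequality
is needed.

*Orthogonality.* The Choi matrices of `A` and `B` are multiples of mutually orthogonal projections
(`HaveOrthogonalChoi`), by the orthogonality of the characters of `ZMod d` for Pauli channels and
because the erasure state is orthogonal to the qudit space for erasure channels. The `n` copies of
the Choi matrix which the non-adaptive protocol produces are therefore again mixtures of orthogonal
projections, with exactly the classical fidelity (`fidelity_storedOp`), so that the bound on the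
Fisher information is attained. Measuring on each copy whether it lies in the support of the Choi
matrix of `B` recovers the coin flips, and their relative frequency is unbiased with variance
`q (1 - q) / n`.
-/

open Filter Topology MeasureTheory ProbabilityTheory
open scoped ENNReal MatrixOrder ComplexOrder Kronecker

noncomputable section

namespace NoiseEstimation

/-! ### The fidelity -/

theorem posSemidef_ofReal_smul {s : Type} {X : Op s} (hX : X.PosSemidef) {c : ℝ} (hc : 0 ≤ c) :
    ((c : ℂ) • X).PosSemidef :=
  hX.smul (by exact_mod_cast hc)

theorem sqrt_posSemidef {s : Type} [Fintype s] [DecidableEq s] (ρ : Op s) :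
    (CFC.sqrt ρ).PosSemidef :=
  Matrix.nonneg_iff_posSemidef.mp (CFC.sqrt_nonneg ρ)

theorem sqrt_mul_sqrt {s : Type} [Fintype s] [DecidableEq s] {ρ : Op s} (hρ : ρ.PosSemidef) :
    CFC.sqrt ρ * CFC.sqrt ρ = ρ :=
  CFC.sqrt_mul_sqrt_self ρ hρ.nonneg

theorem sqrt_eq_of_mul_self {s : Type} [Fintype s] [DecidableEq s] {ρ T : Op s}
    (hT : T.PosSemidef) (h : T * T = ρ) : CFC.sqrt ρ = T :=
  CFC.sqrt_unique h hT.nonneg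

theorem trace_ofReal_smul_re {s : Type} [Fintype s] (c : ℝ) (X : Op s) :
    ((c : ℂ) • X).trace.re = c * X.trace.re := by
  simp [Matrix.trace_smul]

/-- The regularised form of `le_fidelity_of_forall_posDef`. For `S = √σ` and `T = √(SρS)` the
optimal pair `X = S T⁻¹ S`, `X⁻¹ = S⁻¹ T S⁻¹` need not exist, but `S + ε²` and `T + ε` are
invertible, and using them instead costs only `O(ε)`. -/
theorem two_mul_le_fidelity_add {s : Type} [Fintype s] [DecidableEq s] {ρ σ : Op s}
    (hρ : ρ.PosSemidef) (hσ : σ.PosSemidef) {c : ℝ}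
    (h : ∀ X Y : Op s, X.PosDef → Y.PosDef → X * Y = 1 →
      2 * c ≤ (X * ρ).trace.re + (Y * σ).trace.re) {ε : ℝ} (hε : 0 < ε) :
    2 * c ≤ (1 + ε ^ 2) * (fidelity ρ σ + ε * ρ.trace.re) +
      (fidelity ρ σ + ε * Fintype.card s) := by
  set S : Op s := CFC.sqrt σ with hSdef
  have hS : S.PosSemidef := sqrt_posSemidef σ
  have hSS : S * S = σ := sqrt_mul_sqrt hσ
  set T : Op s := CFC.sqrt (S * ρ * S) with hTdef
  have hT : T.PosSemidef := sqrt_posSemidef _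
  have hSH : S.conjTranspose = S := hS.isHermitian
  have hTT : T * T = S * ρ * S := by
    refine sqrt_mul_sqrt ?_
    have := hρ.mul_mul_conjTranspose_same S
    rwa [hSH] at this
  have hF : fidelity ρ σ = T.trace.re := rfl
  have h1 : (1 : Op s).PosDef := Matrix.PosDef.one
  set S' : Op s := S + ((ε ^ 2 : ℝ) : ℂ) • 1 with hS'
  set T' : Op s := T + (ε : ℂ) • 1 with hT'
  have hS'd : S'.PosDef := Matrix.PosDef.posSemidef_add hS (h1.smul (by exact_mod_cast pow_pos hε 2))
  have hT'd : T'.PosDef := Matrix.PosDef.posSemidef_add hT (h1.smul (by exact_mod_cast hε))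
  set U : Op s := S'⁻¹ with hU
  set V : Op s := T'⁻¹ with hV
  have hUd : U.PosDef := hS'd.inv
  have hVd : V.PosDef := hT'd.inv
  have hUH : U.conjTranspose = U := hUd.isHermitian
  have hVH : V.conjTranspose = V := hVd.isHermitian
  have hS'H : S'.conjTranspose = S' := hS'd.isHermitian
  have hS'u : IsUnit S'.det := (Matrix.isUnit_iff_isUnit_det _).mp hS'd.isUnit
  have hT'u : IsUnit T'.det := (Matrix.isUnit_iff_isUnit_det _).mp hT'd.isUnit
  have hUS : U * S' = 1 := Matrix.nonsing_inv_mul _ hS'u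
  have hSU : S' * U = 1 := Matrix.mul_nonsing_inv _ hS'u
  have hVT : V * T' = 1 := Matrix.nonsing_inv_mul _ hT'u
  have hTV : T' * V = 1 := Matrix.mul_nonsing_inv _ hT'u
  have hinj : ∀ W : Op s, IsUnit W → Function.Injective W.vecMul := fun W hW =>
    Matrix.vecMul_injective_of_isUnit hW
  have hX : (S' * V * S').PosDef := by
    have := hVd.mul_mul_conjTranspose_same (B := S') (hinj _ hS'd.isUnit)
    rwa [hS'H] at this
  have hY : (U * T' * U).PosDef := by
    have := hT'd.mul_mul_conjTranspose_same (B := U) (hinj _ hUd.isUnit)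
    rwa [hUH] at this
  have hXY : S' * V * S' * (U * T' * U) = 1 := by
    calc S' * V * S' * (U * T' * U) = S' * V * (S' * U) * T' * U := by simp only [mul_assoc]
      _ = S' * (V * T') * U := by rw [hSU]; simp only [mul_assoc, one_mul]
      _ = 1 := by rw [hVT, mul_one, hSU]
  have key := h _ _ hX hY hXY
  -- `V T = 1 - ε V` is positive, being `V (T T') V`
  have hVT1 : V * T = 1 - (ε : ℂ) • V := by
    rw [eq_sub_iff_add_eq, ← hVT, hT', mul_add, Matrix.mul_smul, mul_one]
  have hVTpos : (V * T).PosSemidef := by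
    have e : V * T = V * (T * T + (ε : ℂ) • T) * V.conjTranspose := by
      rw [hVH]
      calc V * T = V * T * (T' * V) := by rw [hTV, mul_one]
        _ = _ := by rw [hT']; simp only [mul_add, add_mul, Matrix.mul_smul, Matrix.smul_mul,
                      one_mul, mul_assoc]
    rw [e]
    refine Matrix.PosSemidef.mul_mul_conjTranspose_same (.add ?_ (posSemidef_ofReal_smul hT hε.le)) V
    have := Matrix.posSemidef_self_mul_conjTranspose T
    rwa [show T.conjTranspose = T from hT.isHermitian] at this
  have hVTT : (V * (T * T)).trace.re ≤ T.trace.re := by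
    have e : V * (T * T) = T - (ε : ℂ) • (V * T) := by
      rw [← mul_assoc, hVT1, sub_mul, one_mul, Matrix.smul_mul, hVT1]
    have := trace_mul_re_nonneg hVd.posSemidef hT
    rw [e, Matrix.trace_sub, Complex.sub_re, trace_ofReal_smul_re]
    nlinarith
  have hVρ : ε * (V * ρ).trace.re ≤ ρ.trace.re := by
    have := trace_mul_re_nonneg hVTpos hρ
    rw [hVT1, sub_mul, one_mul, Matrix.smul_mul, Matrix.trace_sub, Complex.sub_re,
      trace_ofReal_smul_re] at this
    linarith
  -- `S' ρ S' ≤ (1 + ε²) S ρ S + (1 + ε²) ε² ρ`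
  have hD : (((ε ^ 2 : ℝ) : ℂ) • ((S - 1) * ρ * (S - 1))).PosSemidef := by
    refine posSemidef_ofReal_smul ?_ (by positivity)
    have := hρ.mul_mul_conjTranspose_same (S - 1)
    rwa [Matrix.conjTranspose_sub, hSH, Matrix.conjTranspose_one] at this
  have hDe : ((ε ^ 2 : ℝ) : ℂ) • ((S - 1) * ρ * (S - 1)) =
      ((1 + ε ^ 2 : ℝ) : ℂ) • (T * T) + (((1 + ε ^ 2) * ε ^ 2 : ℝ) : ℂ) • ρ - S' * ρ * S' := by
    rw [hTT, hS']
    simp only [mul_add, add_mul, sub_mul, mul_sub, Matrix.mul_smul, Matrix.smul_mul, mul_one,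
      one_mul]
    push_cast
    module
  have hVD := trace_mul_re_nonneg hVd.posSemidef hD
  rw [hDe, mul_sub, mul_add, Matrix.mul_smul, Matrix.mul_smul, Matrix.trace_sub, Matrix.trace_add,
    Complex.sub_re, Complex.add_re, trace_ofReal_smul_re, trace_ofReal_smul_re] at hVD
  have hXρ : (S' * V * S' * ρ).trace = (V * (S' * ρ * S')).trace := by
    rw [show S' * V * S' * ρ = S' * (V * S' * ρ) by simp only [mul_assoc], Matrix.trace_mul_comm]
    simp only [mul_assoc]
  -- `U S² U ≤ 1`
  have hW : (1 - U * (S * S) * U).PosSemidef := by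
    have e : 1 - U * (S * S) * U =
        U * (((2 * ε ^ 2 : ℝ) : ℂ) • S + ((ε ^ 4 : ℝ) : ℂ) • 1) * U.conjTranspose := by
      rw [hUH]
      have h2 : (1 : Op s) = U * (S' * S') * U := by
        rw [← mul_assoc, hUS, one_mul, hSU]
      nth_rewrite 1 [h2]
      rw [← sub_mul, ← mul_sub]
      congr 2
      rw [hS']
      simp only [mul_add, add_mul, Matrix.mul_smul, Matrix.smul_mul, mul_one, one_mul]
      push_cast
      module
    rw [e]
    exact Matrix.PosSemidef.mul_mul_conjTranspose_same
      (.add (posSemidef_ofReal_smul hS (by positivity))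
        (posSemidef_ofReal_smul .one (by positivity))) U
  have hTW := trace_mul_re_nonneg hT'd.posSemidef hW
  rw [mul_sub, mul_one, Matrix.trace_sub, Complex.sub_re] at hTW
  have hT'tr : T'.trace.re = T.trace.re + ε * Fintype.card s := by
    rw [hT', Matrix.trace_add, Complex.add_re, trace_ofReal_smul_re]
    simp
  have hYσ : (U * T' * U * σ).trace = (T' * (U * (S * S) * U)).trace := by
    rw [← hSS, show U * T' * U * (S * S) = U * (T' * U * (S * S)) by simp only [mul_assoc],
      Matrix.trace_mul_comm]
    simp only [mul_assoc]
  rw [hXρ, hYσ] at key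
  rw [hF]
  have hm : (1 + ε ^ 2) * (V * (T * T)).trace.re ≤ (1 + ε ^ 2) * T.trace.re :=
    mul_le_mul_of_nonneg_left hVTT (by positivity)
  have hm2 : (1 + ε ^ 2) * ε * (ε * (V * ρ).trace.re) ≤ (1 + ε ^ 2) * ε * ρ.trace.re :=
    mul_le_mul_of_nonneg_left hVρ (by positivity)
  nlinarith

/-- The variational lower bound for the fidelity: `F(ρ, σ)` is at least the infimum of
`(Tr Xρ + Tr X⁻¹σ) / 2` over positive definite `X`. -/
theorem le_fidelity_of_forall_posDef {s : Type} [Fintype s] [DecidableEq s] {ρ σ : Op s}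
    (hρ : ρ.PosSemidef) (hσ : σ.PosSemidef) {c : ℝ}
    (h : ∀ X Y : Op s, X.PosDef → Y.PosDef → X * Y = 1 →
      2 * c ≤ (X * ρ).trace.re + (Y * σ).trace.re) : c ≤ fidelity ρ σ := by
  have hlim : Tendsto (fun ε : ℝ => (1 + ε ^ 2) * (fidelity ρ σ + ε * ρ.trace.re) +
      (fidelity ρ σ + ε * Fintype.card s)) (𝓝[>] 0) (𝓝 (2 * fidelity ρ σ)) := by
    refine Tendsto.mono_left ?_ nhdsWithin_le_nhds
    refine Continuous.tendsto' (by fun_prop) _ _ ?_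
    ring
  have := ge_of_tendsto hlim (eventually_mem_nhdsWithin.mono fun ε hε =>
    two_mul_le_fidelity_add hρ hσ h hε)
  linarith

/-- Joint concavity of the fidelity on a common family: two mixtures of the same positive
operators have at least the fidelity of their weights. -/
theorem sum_sqrt_mul_trace_le_fidelity {s ι : Type} [Fintype s] [DecidableEq s]
    (t : Finset ι) (τ : ι → Op s) (hτ : ∀ k ∈ t, (τ k).PosSemidef) (w v : ι → ℝ)
    (hw : ∀ k ∈ t, 0 ≤ w k) (hv : ∀ k ∈ t, 0 ≤ v k) :
    ∑ k ∈ t, √(w k * v k) * (τ k).trace.re ≤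
      fidelity (∑ k ∈ t, (w k : ℂ) • τ k) (∑ k ∈ t, (v k : ℂ) • τ k) := by
  refine le_fidelity_of_forall_posDef
    (Matrix.posSemidef_sum t fun k hk => posSemidef_ofReal_smul (hτ k hk) (hw k hk))
    (Matrix.posSemidef_sum t fun k hk => posSemidef_ofReal_smul (hτ k hk) (hv k hk)) ?_
  intro X Y hX hY hXY
  have hYX : Y * X = 1 := mul_eq_one_comm.mp hXY
  simp only [Matrix.trace_sum, Complex.re_sum, Matrix.mul_smul,
    trace_ofReal_smul_re, ← Finset.sum_add_distrib, Finset.mul_sum]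
  refine Finset.sum_le_sum fun k hk => ?_
  -- `w X + v X⁻¹ - 2 √(wv) = (√w X - √v) X⁻¹ (√w X - √v)` is positive
  have hZ : ((w k : ℂ) • X + (v k : ℂ) • Y - ((2 * √(w k * v k) : ℝ) : ℂ) • 1).PosSemidef := by
    have e : (w k : ℂ) • X + (v k : ℂ) • Y - ((2 * √(w k * v k) : ℝ) : ℂ) • 1 =
        (((√(w k) : ℝ) : ℂ) • X - ((√(v k) : ℝ) : ℂ) • 1) * Y *
          (((√(w k) : ℝ) : ℂ) • X - ((√(v k) : ℝ) : ℂ) • 1).conjTranspose := by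
      have ew : (w k : ℂ) = ((√(w k) : ℝ) : ℂ) * ((√(w k) : ℝ) : ℂ) := by
        rw [← Complex.ofReal_mul, Real.mul_self_sqrt (hw k hk)]
      have ev : (v k : ℂ) = ((√(v k) : ℝ) : ℂ) * ((√(v k) : ℝ) : ℂ) := by
        rw [← Complex.ofReal_mul, Real.mul_self_sqrt (hv k hk)]
      rw [Real.sqrt_mul (hw k hk), Matrix.conjTranspose_sub, Matrix.conjTranspose_smul,
        Matrix.conjTranspose_smul, hX.isHermitian, Matrix.conjTranspose_one]
      simp only [RCLike.star_def, Complex.conj_ofReal, sub_mul, mul_sub, Matrix.smul_mul,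
        Matrix.mul_smul, one_mul, mul_one, hXY, hYX, ew, ev]
      push_cast
      module
    rw [e]
    exact hY.posSemidef.mul_mul_conjTranspose_same _
  have := trace_mul_re_nonneg hZ (hτ k hk)
  rw [sub_mul, add_mul, Matrix.smul_mul, Matrix.smul_mul, Matrix.smul_mul, one_mul,
    Matrix.trace_sub, Matrix.trace_add, Complex.sub_re, Complex.add_re, trace_ofReal_smul_re,
    trace_ofReal_smul_re, trace_ofReal_smul_re] at this
  linarith

/-- Two mixtures of the same mutually orthogonal projections commute, and their fidelity is
classical. -/
theorem fidelity_sum_smul_projection {s ι : Type} [Fintype s] [DecidableEq s] [Fintype ι]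
    [DecidableEq ι] (Q : ι → Op s) (hH : ∀ k, (Q k).IsHermitian)
    (hQ : ∀ k l, Q k * Q l = if k = l then Q k else 0) (w v : ι → ℝ)
    (hw : ∀ k, 0 ≤ w k) (hv : ∀ k, 0 ≤ v k) :
    fidelity (∑ k, (w k : ℂ) • Q k) (∑ k, (v k : ℂ) • Q k) =
      ∑ k, √(w k * v k) * (Q k).trace.re := by
  have hpos : ∀ k, (Q k).PosSemidef := fun k => by
    have := Matrix.posSemidef_self_mul_conjTranspose (Q k)
    rwa [show (Q k).conjTranspose = Q k from hH k, hQ, if_pos rfl] at this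
  have hmul : ∀ f g : ι → ℝ, (∑ k, (f k : ℂ) • Q k) * (∑ k, (g k : ℂ) • Q k) =
      ∑ k, ((f k * g k : ℝ) : ℂ) • Q k := by
    intro f g
    simp only [Finset.sum_mul, Finset.mul_sum, Matrix.smul_mul, Matrix.mul_smul, hQ]
    refine Finset.sum_congr rfl fun k _ => ?_
    simp only [smul_ite, smul_zero, smul_smul]
    rw [Finset.sum_ite_eq', if_pos (Finset.mem_univ k), Complex.ofReal_mul, mul_comm]
  have hsqrt : ∀ f : ι → ℝ, (∀ k, 0 ≤ f k) →
      CFC.sqrt (∑ k, (f k : ℂ) • Q k) = ∑ k, ((√(f k) : ℝ) : ℂ) • Q k := by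
    intro f hf
    refine sqrt_eq_of_mul_self (Matrix.posSemidef_sum _ fun k _ =>
      posSemidef_ofReal_smul (hpos k) (Real.sqrt_nonneg _)) ?_
    rw [hmul]
    simp only [Real.mul_self_sqrt (hf _)]
  have e : ∀ k, √(v k) * w k * √(v k) = w k * v k := fun k => by
    rw [mul_right_comm, Real.mul_self_sqrt (hv k), mul_comm]
  rw [fidelity, hsqrt v hv, hmul, hmul]
  simp only [e]
  rw [hsqrt _ fun k => mul_nonneg (hw k) (hv k), Matrix.trace_sum, Complex.re_sum]
  simp only [trace_ofReal_smul_re]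

/-! ### Adaptive protocols for a mixture of two channels -/

theorem ampliate_apply {R a b : Type} (E : Op a →ₗ[ℂ] Op b) (X : Op (R × a)) (x y : R × b) :
    ampliate R E X x y = E (Matrix.of fun u v => X (x.1, u) (y.1, v)) x.2 y.2 := rfl

theorem IsChannel.ampliate_posSemidef {a b R : Type} [Fintype a] [Fintype b] [Fintype R]
    {E : Op a →ₗ[ℂ] Op b} (hE : IsChannel E) {X : Op (R × a)} (hX : X.PosSemidef) :
    (ampliate R E X).PosSemidef := by
  let e := Fintype.equivFin R
  have h := (hE.completelyPositive _ _
    (hX.submatrix (fun z : Fin (Fintype.card R) × a => (e.symm z.1, z.2)))).submatrix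
    (fun z : R × b => (e z.1, z.2))
  convert h using 1
  ext x y
  simp [ampliate_apply]

theorem IsChannel.map_posSemidef {a b : Type} [Fintype a] [Fintype b]
    {E : Op a →ₗ[ℂ] Op b} (hE : IsChannel E) {X : Op a} (hX : X.PosSemidef) :
    (E X).PosSemidef := by
  have h := (hE.ampliate_posSemidef (R := Unit) (hX.submatrix fun z => z.2)).submatrix
    (fun x : b => ((), x))
  exact h

theorem IsChannel.ampliate_trace {a b R : Type} [Fintype a] [Fintype b] [Fintype R]
    {E : Op a →ₗ[ℂ] Op b} (hE : IsChannel E) (X : Op (R × a)) :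
    (ampliate R E X).trace = X.trace := by
  simp only [Matrix.trace, Matrix.diag_apply, Fintype.sum_prod_type, ampliate_apply]
  refine Finset.sum_congr rfl fun r _ => ?_
  exact hE.tracePreserving (Matrix.of fun u v => X (r, u) (r, v))

theorem ampliate_combination {R a b : Type} (c c' : ℂ) (E E' : Op a →ₗ[ℂ] Op b)
    (X : Op (R × a)) :
    ampliate R (c • E + c' • E') X = c • ampliate R E X + c' • ampliate R E' X := by
  ext x y
  simp [ampliate_apply]

/-- The part of the output of an `n`-probing protocol in which the box acts `k` times as `B` and
`n - k` times as `A`, summed over all orders in which this can happen. -/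
def AdaptiveProtocol.component {a b : Type} [Fintype a] [Fintype b] (P : AdaptiveProtocol a b)
    (A B : Op a →ₗ[ℂ] Op b) : (n : ℕ) → ℕ → Op (P.reg n × a)
  | 0, 0 => P.init
  | 0, _ + 1 => 0
  | n + 1, 0 => P.op n (ampliate (P.reg n) A (P.component A B n 0))
  | n + 1, k + 1 => P.op n (ampliate (P.reg n) A (P.component A B n (k + 1))) +
      P.op n (ampliate (P.reg n) B (P.component A B n k))

theorem AdaptiveProtocol.component_eq_zero {a b : Type} [Fintype a] [Fintype b]
    (P : AdaptiveProtocol a b) (A B : Op a →ₗ[ℂ] Op b) :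
    ∀ n k : ℕ, n < k → P.component A B n k = 0
  | 0, k + 1, _ => rfl
  | n + 1, k + 1, h => by
    rw [component, P.component_eq_zero A B n (k + 1) (by omega),
      P.component_eq_zero A B n k (by omega)]
    simp

theorem AdaptiveProtocol.component_posSemidef {a b : Type} [Fintype a] [Fintype b]
    (P : AdaptiveProtocol a b) {A B : Op a →ₗ[ℂ] Op b} (hA : IsChannel A) (hB : IsChannel B) :
    ∀ n k : ℕ, (P.component A B n k).PosSemidef
  | 0, 0 => P.init_isDensity.1
  | 0, _ + 1 => .zero
  | n + 1, 0 => (P.op_isChannel n).map_posSemidef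
      (hA.ampliate_posSemidef (P.component_posSemidef hA hB n 0))
  | n + 1, k + 1 => ((P.op_isChannel n).map_posSemidef
      (hA.ampliate_posSemidef (P.component_posSemidef hA hB n (k + 1)))).add
      ((P.op_isChannel n).map_posSemidef
        (hB.ampliate_posSemidef (P.component_posSemidef hA hB n k)))

theorem AdaptiveProtocol.component_trace {a b : Type} [Fintype a] [Fintype b]
    (P : AdaptiveProtocol a b) {A B : Op a →ₗ[ℂ] Op b} (hA : IsChannel A) (hB : IsChannel B) :
    ∀ n k : ℕ, (P.component A B n k).trace = (n.choose k : ℂ)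
  | 0, 0 => by simpa [component] using P.init_isDensity.2
  | 0, _ + 1 => by simp [component]
  | n + 1, 0 => by
    rw [component, (P.op_isChannel n).tracePreserving, hA.ampliate_trace,
      P.component_trace hA hB n 0]
    simp
  | n + 1, k + 1 => by
    rw [component, Matrix.trace_add, (P.op_isChannel n).tracePreserving, hA.ampliate_trace,
      (P.op_isChannel n).tracePreserving, hB.ampliate_trace,
      P.component_trace hA hB n (k + 1), P.component_trace hA hB n k, Nat.choose_succ_succ]
    push_cast
    ring

/-- The probability of a prescribed string of `n` bits with `k` ones, when ones have
probability `q`. -/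
def stringWeight (q : ℝ) (n k : ℕ) : ℝ := q ^ k * (1 - q) ^ (n - k)

theorem stringWeight_nonneg {q : ℝ} (hq : q ∈ Set.Icc (0 : ℝ) 1) (n k : ℕ) :
    0 ≤ stringWeight q n k :=
  mul_nonneg (pow_nonneg hq.1 _) (pow_nonneg (sub_nonneg.mpr hq.2) _)

theorem stringWeight_pos {q : ℝ} (hq : q ∈ Set.Ioo (0 : ℝ) 1) (n k : ℕ) :
    0 < stringWeight q n k :=
  mul_pos (pow_pos hq.1 _) (pow_pos (sub_pos.mpr hq.2) _)

/-- Whenever the box is a mixture of two fixed channels, the output of an adaptive protocol depends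
on the parameter only through the binomial weights of fixed positive operators. -/
theorem AdaptiveProtocol.state_eq_sum_component {a b : Type} [Fintype a] [Fintype b]
    (P : AdaptiveProtocol a b) (A B : Op a →ₗ[ℂ] Op b) (q : ℝ) (n : ℕ) :
    P.state (((1 - q : ℝ) : ℂ) • A + (q : ℂ) • B) n =
      ∑ k ∈ Finset.range (n + 1), (stringWeight q n k : ℂ) • P.component A B n k := by
  induction n with
  | zero => simp [state, component, stringWeight]
  | succ n ih =>
    rw [Finset.sum_range_succ', state, ih]
    simp only [component, smul_add, Finset.sum_add_distrib, map_sum, map_smul,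
      ampliate_combination, map_add]
    set α : ℕ → Op (P.reg (n + 1) × a) :=
      fun k => P.op n (ampliate (P.reg n) A (P.component A B n k)) with hα
    set β : ℕ → Op (P.reg (n + 1) × a) :=
      fun k => P.op n (ampliate (P.reg n) B (P.component A B n k)) with hβ
    have h1 : ∑ k ∈ Finset.range (n + 1), (stringWeight q (n + 1) (k + 1) : ℂ) • α (k + 1) +
        (stringWeight q (n + 1) 0 : ℂ) • α 0 =
        ∑ k ∈ Finset.range (n + 1), (stringWeight q n k : ℂ) • ((1 - q : ℝ) : ℂ) • α k := by
      rw [← Finset.sum_range_succ' (fun k => (stringWeight q (n + 1) k : ℂ) • α k),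
        Finset.sum_range_succ]
      have h0 : α (n + 1) = 0 := by
        simp [hα, P.component_eq_zero A B n (n + 1) (by omega)]
      rw [h0, smul_zero, add_zero]
      refine Finset.sum_congr rfl fun k hk => ?_
      have hk' : n + 1 - k = (n - k) + 1 := by
        have := Finset.mem_range.mp hk
        omega
      rw [smul_smul, ← Complex.ofReal_mul, stringWeight, stringWeight, hk', pow_succ, mul_assoc]
    have h2 : ∑ k ∈ Finset.range (n + 1), (stringWeight q (n + 1) (k + 1) : ℂ) • β k =
        ∑ k ∈ Finset.range (n + 1), (stringWeight q n k : ℂ) • (q : ℂ) • β k := by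
      refine Finset.sum_congr rfl fun k _ => ?_
      rw [smul_smul, ← Complex.ofReal_mul, stringWeight, stringWeight, Nat.add_sub_add_right]
      congr 2
      ring
    rw [add_right_comm, h1, h2]

/-- The fidelity of two Bernoulli distributions. -/
def bernoulliFidelity (p q : ℝ) : ℝ := √((1 - p) * (1 - q)) + √(p * q)

theorem bernoulliFidelity_pow (n : ℕ) {p q : ℝ} (hp : p ∈ Set.Icc (0 : ℝ) 1)
    (hq : q ∈ Set.Icc (0 : ℝ) 1) :
    bernoulliFidelity p q ^ n =
      ∑ k ∈ Finset.range (n + 1), √(stringWeight p n k * stringWeight q n k) * n.choose k := by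
  rw [bernoulliFidelity, add_comm, add_pow]
  refine Finset.sum_congr rfl fun k _ => ?_
  have e : stringWeight p n k * stringWeight q n k =
      (√(p * q) ^ k * √((1 - p) * (1 - q)) ^ (n - k)) ^ 2 := by
    rw [mul_pow, ← pow_mul, ← pow_mul, mul_comm k, mul_comm (n - k), pow_mul, pow_mul,
      Real.sq_sqrt (mul_nonneg hp.1 hq.1),
      Real.sq_sqrt (mul_nonneg (sub_nonneg.mpr hp.2) (sub_nonneg.mpr hq.2)), mul_pow, mul_pow,
      stringWeight, stringWeight]
    ring
  rw [e, Real.sqrt_sq (by positivity)]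

/-- No adaptive protocol separates two members of the family better than `n` classical coin
flips do. -/
theorem AdaptiveProtocol.bernoulliFidelity_pow_le_fidelity {a b : Type} [Fintype a] [DecidableEq a]
    [Fintype b] (P : AdaptiveProtocol a b) {A B : Op a →ₗ[ℂ] Op b} (hA : IsChannel A)
    (hB : IsChannel B) (n : ℕ) {p q : ℝ} (hp : p ∈ Set.Icc (0 : ℝ) 1)
    (hq : q ∈ Set.Icc (0 : ℝ) 1) :
    bernoulliFidelity p q ^ n ≤
      fidelity (P.state (((1 - p : ℝ) : ℂ) • A + (p : ℂ) • B) n)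
        (P.state (((1 - q : ℝ) : ℂ) • A + (q : ℂ) • B) n) := by
  rw [P.state_eq_sum_component, P.state_eq_sum_component, bernoulliFidelity_pow n hp hq]
  refine le_trans (le_of_eq ?_) (sum_sqrt_mul_trace_le_fidelity (Finset.range (n + 1))
    (P.component A B n) (fun k _ => P.component_posSemidef hA hB n k) (stringWeight p n)
    (stringWeight q n) (fun k _ => stringWeight_nonneg hp n k)
    (fun k _ => stringWeight_nonneg hq n k))
  simp [P.component_trace hA hB]

/-! ### Expansion of the classical fidelity -/

/-- The exact remainder of the first-order expansion, from the difference of the squares of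
`√(p (p + δ))` and `p + δ / 2`, which is `-δ² / 4`. -/
theorem sqrt_mul_add_eq {p δ : ℝ} (hp : 0 < p) (hδ : 0 ≤ p + δ) :
    √(p * (p + δ)) = p + δ / 2 - δ ^ 2 / 4 / (√(p * (p + δ)) + p + δ / 2) := by
  have hs := Real.sqrt_nonneg (p * (p + δ))
  have hs2 := Real.sq_sqrt (mul_nonneg hp.le hδ)
  have hne : √(p * (p + δ)) + p + δ / 2 ≠ 0 := by linarith
  rw [eq_sub_iff_add_eq, ← eq_sub_iff_add_eq', div_eq_iff hne]
  linarith [hs2]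

theorem tendsto_sqrt_mul_add_denominator {p : ℝ} (hp : 0 < p) :
    Tendsto (fun δ => √(p * (p + δ)) + p + δ / 2) (𝓝 0) (𝓝 (2 * p)) := by
  refine Continuous.tendsto' (by fun_prop) _ _ ?_
  rw [add_zero, Real.sqrt_mul_self hp.le]
  ring

theorem sqrt_mul_add_isLittleO {p : ℝ} (hp : 0 < p) :
    (fun δ : ℝ => √(p * (p + δ)) - (p + δ / 2 - 1 / 8 * (δ ^ 2 / p))) =o[𝓝 0]
      fun δ => δ ^ 2 := by
  have hlim : Tendsto (fun δ => 1 / 8 / p - 1 / 4 / (√(p * (p + δ)) + p + δ / 2)) (𝓝 0)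
      (𝓝 0) := by
    have := (tendsto_const_nhds (x := (1 / 8 / p : ℝ))).sub
      ((tendsto_const_nhds (x := (1 / 4 : ℝ))).div (tendsto_sqrt_mul_add_denominator hp)
        (by positivity))
    rwa [show 1 / 8 / p - 1 / 4 / (2 * p) = 0 by ring] at this
  have hO := ((Asymptotics.isLittleO_one_iff ℝ).mpr hlim).mul_isBigO
    (Asymptotics.isBigO_refl (fun δ : ℝ => δ ^ 2) (𝓝 0))
  refine (hO.congr' ?_ (by simp))
  filter_upwards [eventually_ge_nhds (show -p < 0 by linarith)] with δ hδ
  rw [sub_mul]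
  conv_rhs => rw [sqrt_mul_add_eq hp (by linarith)]
  ring

theorem tendsto_bernoulliFidelity_quotient {p : ℝ} (hp : p ∈ Set.Ioo (0 : ℝ) 1) :
    Tendsto (fun δ => 8 * (1 - bernoulliFidelity p (p + δ)) / δ ^ 2) (𝓝[≠] 0)
      (𝓝 (1 / (p * (1 - p)))) := by
  have hp0 := hp.1
  have hp1 : 0 < 1 - p := sub_pos.mpr hp.2
  have h1 := (tendsto_const_nhds (x := (2 : ℝ))).div (tendsto_sqrt_mul_add_denominator hp0)
    (by positivity)
  have h2' : Tendsto (fun δ => √((1 - p) * (1 - p + -δ)) + (1 - p) + -δ / 2) (𝓝 0)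
      (𝓝 (2 * (1 - p))) :=
    (tendsto_sqrt_mul_add_denominator hp1).comp (Continuous.tendsto' continuous_neg _ _ neg_zero)
  have h2 := (tendsto_const_nhds (x := (2 : ℝ))).div h2' (by positivity)
  have h := (h1.add h2).mono_left (nhdsWithin_le_nhds (s := {0}ᶜ))
  have e : (2 / (2 * p) + 2 / (2 * (1 - p)) : ℝ) = 1 / (p * (1 - p)) := by
    field_simp
    ring
  rw [e] at h
  refine h.congr' ?_
  have ev : ∀ᶠ δ : ℝ in 𝓝[≠] 0, 0 ≤ p + δ ∧ 0 ≤ 1 - p + -δ := by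
    refine nhdsWithin_le_nhds ?_
    filter_upwards [eventually_ge_nhds (show -p < 0 by linarith),
      eventually_le_nhds (show 0 < 1 - p from hp1)] with δ h1 h2
    constructor <;> linarith
  filter_upwards [ev, self_mem_nhdsWithin] with δ hδ hne
  have hne : δ ≠ 0 := hne
  rw [bernoulliFidelity, show 1 - (p + δ) = 1 - p + -δ by ring]
  conv_rhs => rw [sqrt_mul_add_eq hp0 hδ.1, sqrt_mul_add_eq hp1 hδ.2]
  simp only [Pi.div_apply]
  field_simp
  ring

theorem tendsto_bernoulliFidelity_pow_quotient {p : ℝ} (hp : p ∈ Set.Ioo (0 : ℝ) 1) (n : ℕ) :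
    Tendsto (fun δ => 8 * (1 - bernoulliFidelity p (p + δ) ^ n) / δ ^ 2) (𝓝[≠] 0)
      (𝓝 (n / (p * (1 - p)))) := by
  have hf : Tendsto (fun δ => ∑ i ∈ Finset.range n, bernoulliFidelity p (p + δ) ^ i) (𝓝[≠] 0)
      (𝓝 n) := by
    refine Tendsto.mono_left (Continuous.tendsto' (by unfold bernoulliFidelity; fun_prop) _ _ ?_)
      nhdsWithin_le_nhds
    have : bernoulliFidelity p p = 1 := by
      rw [bernoulliFidelity, Real.sqrt_mul_self hp.1.le,
        Real.sqrt_mul_self (sub_nonneg.mpr hp.2.le)]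
      ring
    simp [this]
  have h := hf.mul (tendsto_bernoulliFidelity_quotient hp)
  rw [mul_one_div] at h
  refine h.congr fun δ => ?_
  rw [← mul_neg_geom_sum]
  ring

theorem eventually_add_mem_Icc {p : ℝ} (hp : p ∈ Set.Ioo (0 : ℝ) 1) :
    ∀ᶠ δ : ℝ in 𝓝[≠] 0, p + δ ∈ Set.Icc (0 : ℝ) 1 := by
  have hc : Tendsto (fun δ : ℝ => p + δ) (𝓝[≠] 0) (𝓝 p) :=
    (Continuous.tendsto' (by fun_prop) _ _ (add_zero p)).mono_left nhdsWithin_le_nhds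
  exact hc (Icc_mem_nhds hp.1 hp.2)

theorem HasQFI.qfi_eq {a : Type} [Fintype a] [DecidableEq a] {ρ : ℝ → Op a} {θ I : ℝ}
    (h : HasQFI ρ θ I) : qfi ρ θ = ENNReal.ofReal I :=
  ((ENNReal.continuous_ofReal.tendsto I).comp h).limsup_eq

theorem qfi_state_le {a b : Type} [Fintype a] [DecidableEq a] [Fintype b]
    (P : AdaptiveProtocol a b) {A B : Op a →ₗ[ℂ] Op b} (hA : IsChannel A) (hB : IsChannel B)
    (n : ℕ) {p : ℝ} (hp : p ∈ Set.Ioo (0 : ℝ) 1) :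
    qfi (fun q => P.state (((1 - q : ℝ) : ℂ) • A + (q : ℂ) • B) n) p ≤
      ENNReal.ofReal (n / (p * (1 - p))) := by
  have hlim := (ENNReal.continuous_ofReal.tendsto _).comp
    (tendsto_bernoulliFidelity_pow_quotient hp n)
  rw [← hlim.limsup_eq]
  refine limsup_le_limsup ?_
  filter_upwards [eventually_add_mem_Icc hp] with δ hδ
  refine ENNReal.ofReal_le_ofReal ?_
  have := P.bernoulliFidelity_pow_le_fidelity hA hB n (Set.Ioo_subset_Icc_self hp) hδ
  exact div_le_div_of_nonneg_right (by linarith) (sq_nonneg δ)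

/-! ### Binomial moments -/

theorem sum_stringWeight_mul_choose (p : ℝ) (n : ℕ) :
    ∑ k ∈ Finset.range (n + 1), stringWeight p n k * n.choose k = 1 := by
  simp only [stringWeight]
  rw [← add_pow, add_sub_cancel, one_pow]

theorem stringWeight_mul_choose_eq (p : ℝ) (n k : ℕ) :
    stringWeight p n k * n.choose k = (bernsteinPolynomial ℝ n k).eval p := by
  simp [bernsteinPolynomial, stringWeight]
  ring

theorem sum_stringWeight_mul_sub_mul_choose (p : ℝ) (n : ℕ) :
    ∑ k ∈ Finset.range (n + 1), stringWeight p n k * (k - n * p) * n.choose k = 0 := by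
  have h := congrArg (Polynomial.eval p) (bernsteinPolynomial.sum_smul ℝ n)
  simp only [Polynomial.eval_finsetSum, nsmul_eq_mul, Polynomial.eval_mul,
    Polynomial.eval_natCast, Polynomial.eval_X, ← stringWeight_mul_choose_eq] at h
  have h0 := sum_stringWeight_mul_choose p n
  calc _ = ∑ k ∈ Finset.range (n + 1), (k : ℝ) * (stringWeight p n k * n.choose k) -
        n * p * ∑ k ∈ Finset.range (n + 1), stringWeight p n k * n.choose k := by
        rw [Finset.mul_sum, ← Finset.sum_sub_distrib]
        exact Finset.sum_congr rfl fun k _ => by ring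
    _ = 0 := by rw [h, h0]; ring

theorem sum_stringWeight_mul_sub_sq_mul_choose (p : ℝ) (n : ℕ) :
    ∑ k ∈ Finset.range (n + 1), stringWeight p n k * (k - n * p) ^ 2 * n.choose k =
      n * p * (1 - p) := by
  have h := congrArg (Polynomial.eval p) (bernsteinPolynomial.variance (R := ℝ) n)
  simp only [Polynomial.eval_finsetSum, nsmul_eq_mul, Polynomial.eval_mul, Polynomial.eval_pow,
    Polynomial.eval_natCast, Polynomial.eval_X, Polynomial.eval_sub, Polynomial.eval_one,
    ← stringWeight_mul_choose_eq] at h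
  rw [← h]
  exact Finset.sum_congr rfl fun k _ => by ring

theorem hasDerivAt_stringWeight {p : ℝ} (hp : p ∈ Set.Ioo (0 : ℝ) 1) {n k : ℕ} (hk : k ≤ n) :
    HasDerivAt (fun q => stringWeight q n k)
      (stringWeight p n k * (k - n * p) / (p * (1 - p))) p := by
  have hp0 : p ≠ 0 := hp.1.ne'
  have hp1 : 1 - p ≠ 0 := (sub_pos.mpr hp.2).ne'
  have hpow : ∀ (x : ℝ) (j : ℕ), x ≠ 0 → (j : ℝ) * x ^ (j - 1) = j * x ^ j / x := by
    intro x j hx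
    cases j with
    | zero => simp
    | succ j => rw [pow_succ, Nat.add_sub_cancel]; field_simp
  have h := (hasDerivAt_pow k p).mul (((hasDerivAt_id p).const_sub 1).pow (n - k))
  refine h.congr_deriv ?_
  simp only [id, Pi.pow_apply]
  rw [hpow p k hp0, hpow (1 - p) (n - k) hp1, stringWeight, Nat.cast_sub hk]
  field_simp
  ring

/-! ### The law of an estimator -/

section Law

variable {s : Type} [Fintype s] [DecidableEq s]

theorem EstimatorPOVM.law_apply (M : EstimatorPOVM s) {ρ : Op s} (hρ : ρ.PosSemidef) {A : Set ℝ}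
    (hA : MeasurableSet A) : M.law ρ A = ENNReal.ofReal (ρ * M.effect A).trace.re := by
  rw [EstimatorPOVM.law, dif_pos hρ, Measure.ofMeasurable_apply A hA]

theorem EstimatorPOVM.law_univ (M : EstimatorPOVM s) {ρ : Op s} (hρ : ρ.PosSemidef) :
    M.law ρ Set.univ = ENNReal.ofReal ρ.trace.re := by
  rw [M.law_apply hρ .univ, M.univ, mul_one]

theorem EstimatorPOVM.isFiniteMeasure_law (M : EstimatorPOVM s) {ρ : Op s} (hρ : ρ.PosSemidef) :
    IsFiniteMeasure (M.law ρ) :=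
  ⟨by rw [M.law_univ hρ]; exact ENNReal.ofReal_lt_top⟩

theorem EstimatorPOVM.law_sum (M : EstimatorPOVM s) {ι : Type} (t : Finset ι) (w : ι → ℝ)
    (τ : ι → Op s) (hw : ∀ k ∈ t, 0 ≤ w k) (hτ : ∀ k ∈ t, (τ k).PosSemidef) :
    M.law (∑ k ∈ t, (w k : ℂ) • τ k) = ∑ k ∈ t, ENNReal.ofReal (w k) • M.law (τ k) := by
  ext A hA
  rw [M.law_apply (Matrix.posSemidef_sum t fun k hk => posSemidef_ofReal_smul (hτ k hk) (hw k hk))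
    hA, Finset.sum_mul, Matrix.trace_sum, Complex.re_sum, ENNReal.ofReal_sum_of_nonneg]
  · rw [Measure.coe_finsetSum, Finset.sum_apply]
    refine Finset.sum_congr rfl fun k hk => ?_
    rw [Measure.smul_apply, M.law_apply (hτ k hk) hA, Matrix.smul_mul, trace_ofReal_smul_re,
      ENNReal.ofReal_mul (hw k hk), smul_eq_mul]
  · intro k hk
    rw [Matrix.smul_mul, trace_ofReal_smul_re]
    exact mul_nonneg (hw k hk) (trace_mul_re_nonneg (hτ k hk) (M.posSemidef A hA))

end Law

theorem ofReal_sum_le_sum_ofReal {ι : Type} (t : Finset ι) (f : ι → ℝ) :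
    ENNReal.ofReal (∑ k ∈ t, f k) ≤ ∑ k ∈ t, ENNReal.ofReal (f k) :=
  (ENNReal.ofReal_le_ofReal (Finset.sum_le_sum fun k _ => le_max_left (f k) 0)).trans
    (by
      rw [ENNReal.ofReal_sum_of_nonneg fun k _ => le_max_right (f k) 0]
      refine Finset.sum_le_sum fun k _ => ?_
      rcases le_total (f k) 0 with h | h
      · simp [max_eq_right h]
      · rw [max_eq_left h])

theorem ofReal_integral_le_lintegral_ofReal {α : Type} [MeasurableSpace α] {μ : Measure α}
    {f : α → ℝ} (hf : Integrable f μ) :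
    ENNReal.ofReal (∫ x, f x ∂μ) ≤ ∫⁻ x, ENNReal.ofReal (f x) ∂μ := by
  have h : ∫ x, f x ∂μ ≤ ∫ x, max (f x) 0 ∂μ :=
    integral_mono hf hf.pos_part fun x => le_max_left _ _
  refine (ENNReal.ofReal_le_ofReal h).trans ?_
  rw [ofReal_integral_eq_lintegral_ofReal hf.pos_part (ae_of_all _ fun x => le_max_right _ _)]
  refine lintegral_mono fun x => ?_
  rcases le_total (f x) 0 with h | h
  · simp [max_eq_right h]
  · rw [max_eq_left h]

/-- The second moment about `p` is bounded below by a tangent line of the square. -/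
theorem ofReal_tangent_le_lintegral {μ : Measure ℝ} [IsFiniteMeasure μ]
    (hμ : Integrable (fun x : ℝ => x) μ) (p l : ℝ) :
    ENNReal.ofReal (2 * l * (∫ x, x ∂μ - p * μ.real Set.univ) - l ^ 2 * μ.real Set.univ) ≤
      ∫⁻ x, ENNReal.ofReal ((x - p) ^ 2) ∂μ := by
  have hi : Integrable (fun x : ℝ => 2 * l * (x - p) - l ^ 2) μ :=
    ((hμ.sub (integrable_const p)).const_mul (2 * l)).sub (integrable_const _)
  have he : ∫ x, (2 * l * (x - p) - l ^ 2) ∂μ =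
      2 * l * (∫ x, x ∂μ - p * μ.real Set.univ) - l ^ 2 * μ.real Set.univ := by
    have hi' : Integrable (fun x : ℝ => 2 * l * (x - p)) μ :=
      (hμ.sub (integrable_const p)).const_mul (2 * l)
    rw [integral_sub hi' (integrable_const _), integral_const_mul,
      integral_sub hμ (integrable_const p), integral_const, integral_const]
    simp only [smul_eq_mul]
    ring
  rw [← he]
  refine (ofReal_integral_le_lintegral_ofReal hi).trans (lintegral_mono fun x => ?_)
  exact ENNReal.ofReal_le_ofReal (by nlinarith [sq_nonneg (x - p - l)])

/-- The Cramér–Rao bound for binomial mixtures of fixed positive operators. Differentiating the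
condition of unbiasedness gives the covariance `p (1 - p)` of the estimate with the number of
errors; the tangents to the square with slopes proportional to the score turn this into the lower
bound for the variance. -/
theorem ofReal_le_estimatorVariance {s : Type} [Fintype s] [DecidableEq s] (M : EstimatorPOVM s)
    {n : ℕ} (hn : 1 ≤ n) (τ : ℕ → Op s) (hτ : ∀ k, (τ k).PosSemidef)
    (htr : ∀ k, (τ k).trace = (n.choose k : ℂ)) {p : ℝ} (hp : p ∈ Set.Ioo (0 : ℝ) 1)
    (hM : LocallyUnbiased M
      (fun q => ∑ k ∈ Finset.range (n + 1), (stringWeight q n k : ℂ) • τ k) p) :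
    ENNReal.ofReal (p * (1 - p) / n) ≤
      estimatorVariance M (∑ k ∈ Finset.range (n + 1), (stringWeight p n k : ℂ) • τ k) := by
  have hfin : ∀ k, IsFiniteMeasure (M.law (τ k)) := fun k => M.isFiniteMeasure_law (hτ k)
  have hlaw : ∀ q ∈ Set.Ioo (0 : ℝ) 1,
      M.law (∑ k ∈ Finset.range (n + 1), (stringWeight q n k : ℂ) • τ k) =
        ∑ k ∈ Finset.range (n + 1), ENNReal.ofReal (stringWeight q n k) • M.law (τ k) :=
    fun q hq => M.law_sum _ _ _ (fun k _ => (stringWeight_pos hq n k).le) fun k _ => hτ k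
  have hint : ∀ k ∈ Finset.range (n + 1), Integrable (fun x : ℝ => x) (M.law (τ k)) := by
    have h := hM.self_of_nhds.1
    simp only [hlaw p hp] at h
    intro k hk
    have h' := (integrable_finsetSum_measure.mp h) k hk
    rwa [integrable_smul_measure
      (by simpa using stringWeight_pos hp n k) ENNReal.ofReal_ne_top] at h'
  have hmass : ∀ k, (M.law (τ k)).real Set.univ = n.choose k := fun k => by
    rw [Measure.real, M.law_univ (hτ k), htr]
    simp
  set m : ℕ → ℝ := fun k => ∫ x, x ∂(M.law (τ k))
  have hmean : (fun q => ∑ k ∈ Finset.range (n + 1), stringWeight q n k * m k) =ᶠ[𝓝 p]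
      fun q => q := by
    filter_upwards [hM, Ioo_mem_nhds hp.1 hp.2] with q hq hq'
    have h := hq.2
    simp only [hlaw q hq'] at h
    rw [integral_finsetSum_measure fun k hk =>
      (hint k hk).smul_measure ENNReal.ofReal_ne_top] at h
    simp only [integral_smul_measure, smul_eq_mul,
      ENNReal.toReal_ofReal (stringWeight_pos hq' n _).le] at h
    exact h
  have hcov : ∑ k ∈ Finset.range (n + 1), stringWeight p n k * (k - n * p) * m k =
      p * (1 - p) := by
    have h1 : HasDerivAt (fun q => ∑ k ∈ Finset.range (n + 1), stringWeight q n k * m k)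
        (∑ k ∈ Finset.range (n + 1),
          stringWeight p n k * (k - n * p) / (p * (1 - p)) * m k) p :=
      HasDerivAt.fun_sum fun k hk =>
        (hasDerivAt_stringWeight hp (Nat.lt_succ_iff.mp (Finset.mem_range.mp hk))).mul_const _
    have h2 := (h1.congr_of_eventuallyEq hmean.symm).unique (hasDerivAt_id' p)
    have hne : p * (1 - p) ≠ 0 := (mul_pos hp.1 (sub_pos.mpr hp.2)).ne'
    have h3 := congrArg (fun x => p * (1 - p) * x) h2
    simp only [Finset.mul_sum, mul_one] at h3
    rw [← h3]
    refine Finset.sum_congr rfl fun k _ => ?_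
    rw [← mul_assoc, mul_div_cancel₀ _ hne]
  have hp' : ∫ x, x ∂(M.law (∑ k ∈ Finset.range (n + 1), (stringWeight p n k : ℂ) • τ k)) = p :=
    hM.self_of_nhds.2
  rw [estimatorVariance, evariance_eq_lintegral_ofReal, hp', hlaw p hp, lintegral_finsetSum_measure]
  simp only [lintegral_smul_measure, smul_eq_mul]
  have hn0 : (n : ℝ) ≠ 0 := by positivity
  -- the slopes `(k - n p) / n` are optimal
  calc ENNReal.ofReal (p * (1 - p) / n)
      = ENNReal.ofReal (∑ k ∈ Finset.range (n + 1), stringWeight p n k *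
          (2 * ((k - n * p) / n) * (m k - p * (M.law (τ k)).real Set.univ) -
            ((k - n * p) / n) ^ 2 * (M.law (τ k)).real Set.univ)) := by
        congr 1
        have e : ∀ k : ℕ, stringWeight p n k *
            (2 * ((k - n * p) / n) * (m k - p * (M.law (τ k)).real Set.univ) -
              ((k - n * p) / n) ^ 2 * (M.law (τ k)).real Set.univ) =
            2 / n * (stringWeight p n k * (k - n * p) * m k) -
            2 * p / n * (stringWeight p n k * (k - n * p) * n.choose k) -
            1 / n ^ 2 * (stringWeight p n k * (k - n * p) ^ 2 * n.choose k) := fun k => by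
          rw [hmass]
          field_simp
        simp only [e, Finset.sum_sub_distrib, ← Finset.mul_sum]
        rw [hcov, sum_stringWeight_mul_sub_mul_choose, sum_stringWeight_mul_sub_sq_mul_choose]
        field_simp
        ring
    _ ≤ _ := ofReal_sum_le_sum_ofReal _ _
    _ ≤ _ := by
        refine Finset.sum_le_sum fun k hk => ?_
        rw [ENNReal.ofReal_mul (stringWeight_pos hp n k).le]
        gcongr
        exact ofReal_tangent_le_lintegral (hint k hk) p _

/-! ### Measurements with finitely many outcomes -/

/-- The measurement with the positive operators `X k` for its outcomes, and the estimate `f k` in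
case of outcome `k`. -/
def finitePOVM {s ι : Type} [Fintype s] [DecidableEq s] [Fintype ι] (X : ι → Op s)
    (hX : ∀ k, (X k).PosSemidef) (h1 : ∑ k, X k = 1) (f : ι → ℝ) : EstimatorPOVM s where
  effect A := ∑ k, A.indicator (fun _ => X k) (f k)
  posSemidef A _ := Matrix.posSemidef_sum _ fun k _ => by
    by_cases h : f k ∈ A
    · simpa [h] using hX k
    · simpa [h] using Matrix.PosSemidef.zero
  univ := by simpa using h1
  iUnion A _ hd := hasSum_sum fun k _ => by
    by_cases h : f k ∈ ⋃ i, A i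
    · obtain ⟨j, hj⟩ := Set.mem_iUnion.mp h
      have hs := hasSum_single (f := fun i => (A i).indicator (fun _ => X k) (f k)) j
        fun i hi => Set.indicator_of_notMem
          (fun h' => Set.disjoint_left.mp (hd hi) h' hj) _
      rw [Set.indicator_of_mem hj] at hs
      rwa [Set.indicator_of_mem h]
    · rw [Set.indicator_of_notMem h]
      have : ∀ i, (A i).indicator (fun _ => X k) (f k) = (0 : Op s) := fun i =>
        Set.indicator_of_notMem (fun h' => h (Set.mem_iUnion.mpr ⟨i, h'⟩)) _
      simpa only [this] using hasSum_zero

theorem finitePOVM_law {s ι : Type} [Fintype s] [DecidableEq s] [Fintype ι] (X : ι → Op s)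
    (hX : ∀ k, (X k).PosSemidef) (h1 : ∑ k, X k = 1) (f : ι → ℝ) {ρ : Op s}
    (hρ : ρ.PosSemidef) :
    (finitePOVM X hX h1 f).law ρ =
      ∑ k, ENNReal.ofReal (ρ * X k).trace.re • Measure.dirac (f k) := by
  ext A hA
  rw [EstimatorPOVM.law_apply _ hρ hA, Measure.coe_finsetSum, Finset.sum_apply]
  simp only [finitePOVM, Finset.mul_sum, Matrix.trace_sum, Complex.re_sum]
  rw [ENNReal.ofReal_sum_of_nonneg]
  · refine Finset.sum_congr rfl fun k _ => ?_
    by_cases h : f k ∈ A <;> simp [h, hA]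
  · intro k _
    by_cases h : f k ∈ A
    · simpa [h] using trace_mul_re_nonneg hρ (hX k)
    · simp [h]

/-! ### Tensor powers -/

section PiOp

variable {c : Type} {n : ℕ}

/-- The tensor product of `n` operators on the same system. -/
def piOp (M : Fin n → Op c) : Op (Fin n → c) :=
  Matrix.of fun x y => ∏ i, M i (x i) (y i)

theorem piOp_apply (M : Fin n → Op c) (x y : Fin n → c) :
    piOp M x y = ∏ i, M i (x i) (y i) := rfl

theorem piOp_conjTranspose (M : Fin n → Op c) :
    (piOp M).conjTranspose = piOp fun i => (M i).conjTranspose := by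
  ext x y
  simp [piOp_apply, Matrix.conjTranspose_apply]

theorem piOp_one [DecidableEq c] : piOp (fun _ : Fin n => (1 : Op c)) = 1 := by
  ext x y
  simp only [piOp_apply, Matrix.one_apply, Finset.prod_ite_zero, Finset.prod_const_one,
    Finset.mem_univ, forall_const, funext_iff]

theorem piOp_sum_smul {ι : Type} [Fintype ι] (w : ι → ℂ) (Q : ι → Op c) :
    piOp (fun _ : Fin n => ∑ k, w k • Q k) =
      ∑ x : Fin n → ι, (∏ i, w (x i)) • piOp fun i => Q (x i) := by
  ext u v
  simp only [piOp_apply, Matrix.sum_apply, Matrix.smul_apply, smul_eq_mul, Finset.prod_univ_sum,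
    Fintype.piFinset_univ, Finset.prod_mul_distrib]

variable [Fintype c]

theorem piOp_mul (M N : Fin n → Op c) : piOp M * piOp N = piOp fun i => M i * N i := by
  ext x y
  simp only [Matrix.mul_apply, piOp_apply, Finset.prod_univ_sum, Fintype.piFinset_univ,
    Finset.prod_mul_distrib]

theorem piOp_trace (M : Fin n → Op c) : (piOp M).trace = ∏ i, (M i).trace := by
  simp only [Matrix.trace, Matrix.diag_apply, piOp_apply, Finset.prod_univ_sum,
    Fintype.piFinset_univ]

theorem piOp_posSemidef [DecidableEq c] {M : Fin n → Op c} (hM : ∀ i, (M i).PosSemidef) :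
    (piOp M).PosSemidef := by
  have h : piOp M = (piOp fun i => CFC.sqrt (M i)) *
      (piOp fun i => CFC.sqrt (M i)).conjTranspose := by
    rw [piOp_conjTranspose, piOp_mul]
    congr 1
    funext i
    rw [show (CFC.sqrt (M i)).conjTranspose = CFC.sqrt (M i) from
      (sqrt_posSemidef (M i)).isHermitian, sqrt_mul_sqrt (hM i)]
  rw [h]
  exact Matrix.posSemidef_self_mul_conjTranspose _

end PiOp

/-! ### The output of the entanglement-based protocol -/

section BellState

variable {a b : Type} {n : ℕ}

/-- The operator `M` on the stored pairs together with `N` on the pair kept in reserve. -/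
def storedOp (M : Op (Fin n → a × b)) (N : Op (a × a)) : Op (BellReg a b n × a) :=
  (M ⊗ₖ N).submatrix (Equiv.prodAssoc (Fin n → a × b) a a)
    (Equiv.prodAssoc (Fin n → a × b) a a)

theorem storedOp_one [DecidableEq a] [DecidableEq b] : storedOp (1 : Op (Fin n → a × b)) (1 : Op (a × a)) = 1 := by
  rw [storedOp, Matrix.one_kronecker_one, Matrix.submatrix_one_equiv]

theorem storedOp_sum_smul {ι : Type} [Fintype ι] (w : ι → ℂ) (M : ι → Op (Fin n → a × b))
    (N : Op (a × a)) : storedOp (∑ k, w k • M k) N = ∑ k, w k • storedOp (M k) N := by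
  ext x y
  simp [storedOp, Matrix.sum_apply, Finset.sum_mul, mul_assoc]

variable [Fintype a] [Fintype b]

theorem storedOp_mul (M M' : Op (Fin n → a × b)) (N N' : Op (a × a)) :
    storedOp M N * storedOp M' N' = storedOp (M * M') (N * N') := by
  rw [storedOp, storedOp, Matrix.submatrix_mul_equiv, ← Matrix.mul_kronecker_mul, storedOp]

theorem storedOp_trace (M : Op (Fin n → a × b)) (N : Op (a × a)) :
    (storedOp M N).trace = M.trace * N.trace := by
  rw [← Matrix.trace_kronecker]
  exact (Equiv.prodAssoc (Fin n → a × b) a a).sum_comp fun w => (M ⊗ₖ N) w w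

theorem storedOp_posSemidef {M : Op (Fin n → a × b)} {N : Op (a × a)} (hM : M.PosSemidef)
    (hN : N.PosSemidef) : (storedOp M N).PosSemidef :=
  (hM.kronecker hN).submatrix _

theorem bell_mul_bell (a : Type) [Fintype a] [DecidableEq a] [Nonempty a] :
    bell a * bell a = bell a := by
  have h : star (bellVector a) ⬝ᵥ bellVector a = 1 := by
    rw [← bell_trace a, bell, Matrix.trace_vecMulVec, dotProduct_comm]
  rw [bell, Matrix.vecMulVec_mul_vecMulVec, h, one_smul]

variable [DecidableEq a] [DecidableEq b] [Nonempty a]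

/-- The output of the entanglement-based protocol consists of `n` copies of the Choi matrix, next to
the pair kept in reserve. -/
theorem bellProtocol_state (E : Op a →ₗ[ℂ] Op b) (n : ℕ) :
    (bellProtocol a b).state E n = storedOp (n := n) (piOp fun _ => choi E) (bell a) := by
  induction n with
  | zero =>
    ext x y
    change bell a (x.1.2, x.2) (y.1.2, y.2) =
      (∏ i : Fin 0, choi E (x.1.1 i) (y.1.1 i)) * bell a (x.1.2, x.2) (y.1.2, y.2)
    simp
  | succ n ih =>
    rw [AdaptiveProtocol.state, ih]
    ext ⟨⟨h, r⟩, t⟩ ⟨⟨h', r'⟩, t'⟩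
    change E (Matrix.of fun u v =>
        piOp (fun _ => choi E) (Fin.init h) (Fin.init h') *
          bell a ((h (Fin.last n)).1, u) ((h' (Fin.last n)).1, v))
        (h (Fin.last n)).2 (h' (Fin.last n)).2 * bell a (r, t) (r', t') =
      piOp (fun _ => choi E) h h' * bell a (r, t) (r', t')
    congr 1
    have e : (Matrix.of fun u v => piOp (fun _ => choi E) (Fin.init h) (Fin.init h') *
          bell a ((h (Fin.last n)).1, u) ((h' (Fin.last n)).1, v)) =
        piOp (fun _ => choi E) (Fin.init h) (Fin.init h') • Matrix.of fun u v =>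
          bell a ((h (Fin.last n)).1, u) ((h' (Fin.last n)).1, v) := rfl
    rw [e, map_smul, Matrix.smul_apply, smul_eq_mul, piOp_apply _ h h', Fin.prod_univ_castSucc]
    rfl

/-- On the states prepared by the entanglement-based protocol, the fidelity is multiplicative. -/
theorem fidelity_storedOp {ι : Type} [Fintype ι] [DecidableEq ι] (Q : ι → Op (a × b))
    (hH : ∀ k, (Q k).IsHermitian) (hQ : ∀ k l, Q k * Q l = if k = l then Q k else 0)
    (w v : ι → ℝ) (hw : ∀ k, 0 ≤ w k) (hv : ∀ k, 0 ≤ v k) :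
    fidelity (storedOp (n := n) (piOp fun _ => ∑ k, (w k : ℂ) • Q k) (bell a))
        (storedOp (n := n) (piOp fun _ => ∑ k, (v k : ℂ) • Q k) (bell a)) =
      (∑ k, √(w k * v k) * (Q k).trace.re) ^ n := by
  have hpos : ∀ k, (Q k).PosSemidef := fun k => by
    have := Matrix.posSemidef_self_mul_conjTranspose (Q k)
    rwa [show (Q k).conjTranspose = Q k from hH k, hQ, if_pos rfl] at this
  have htr : ∀ k, (Q k).trace = ((Q k).trace.re : ℂ) := fun k => by
    rw [← Complex.eq_re_of_ofReal_le (r := 0) (by simpa using (hpos k).trace_nonneg)]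
  have hprod : ∀ (f : ι → ℝ) (x : Fin n → ι),
      ∏ i, (f (x i) : ℂ) = ((∏ i, f (x i) : ℝ) : ℂ) := fun f x => by push_cast; rfl
  rw [piOp_sum_smul, piOp_sum_smul, storedOp_sum_smul, storedOp_sum_smul]
  simp only [hprod]
  rw [fidelity_sum_smul_projection]
  · have e : ∀ x : Fin n → ι, √((∏ i, w (x i)) * ∏ i, v (x i)) *
        (storedOp (piOp fun i => Q (x i)) (bell a)).trace.re =
          ∏ i, (√(w (x i) * v (x i)) * (Q (x i)).trace.re) := fun x => by
      rw [storedOp_trace, bell_trace, mul_one, piOp_trace, Finset.prod_congr rfl fun i _ => htr (x i),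
        hprod (fun k => (Q k).trace.re), Complex.ofReal_re, ← Finset.prod_mul_distrib,
        Real.sqrt_prod _ fun i _ => mul_nonneg (hw _) (hv _), Finset.prod_mul_distrib]
    simp only [e]
    rw [← Fintype.piFinset_univ, ← Finset.prod_univ_sum (fun _ => Finset.univ)
      (fun _ k => √(w k * v k) * (Q k).trace.re)]
    simp
  · exact fun x => (storedOp_posSemidef (piOp_posSemidef fun i => hpos (x i))
      (bell_posSemidef a)).isHermitian
  · intro x y
    rw [storedOp_mul, piOp_mul, bell_mul_bell]
    split_ifs with h
    · subst h
      simp only [hQ, if_true]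
    · obtain ⟨i, hi⟩ := Function.ne_iff.mp h
      have : piOp (fun i => Q (x i) * Q (y i)) = 0 := by
        ext u v
        rw [piOp_apply]
        refine Finset.prod_eq_zero (Finset.mem_univ i) ?_
        rw [hQ, if_neg hi, Matrix.zero_apply]
      rw [this]
      ext u v
      simp [storedOp]
  · exact fun x => Finset.prod_nonneg fun i _ => hw _
  · exact fun x => Finset.prod_nonneg fun i _ => hv _

end BellState

/-! ### Mixtures of two channels with orthogonal Choi matrices -/

/-- Two channels whose Choi matrices are multiples of mutually orthogonal projections, that of `A`
being `Q false` itself and that of `B` being `c • Q true`. -/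
structure HaveOrthogonalChoi {a b : Type} [Fintype a] [DecidableEq a] [Fintype b]
    (A B : Op a →ₗ[ℂ] Op b) (Q : Bool → Op (a × b)) (c : ℝ) : Prop where
  isChannel_left : IsChannel A
  isChannel_right : IsChannel B
  isHermitian : ∀ k, (Q k).IsHermitian
  mul_eq : ∀ k l, Q k * Q l = if k = l then Q k else 0
  choi_left : choi A = Q false
  choi_right : choi B = (c : ℂ) • Q true
  nonneg : 0 ≤ c

/-- The weights of the two projections in the Choi matrix of the mixture `(1 - q) A + q B`. -/
def projectionWeight (c q : ℝ) (k : Bool) : ℝ := if k then q * c else 1 - q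

/-- The distribution of one bit that is `true` with probability `q`. -/
def bitWeight (q : ℝ) (k : Bool) : ℝ := if k then q else 1 - q

theorem prod_bitWeight {n : ℕ} (q : ℝ) (x : Fin n → Bool) :
    ∏ i, bitWeight q (x i) = stringWeight q n (Finset.univ.filter fun i => x i = true).card := by
  simp only [bitWeight, Finset.prod_ite, Finset.prod_const, stringWeight]
  congr 2
  have := Finset.card_filter_add_card_filter_not (s := (Finset.univ : Finset (Fin n)))
    (fun i => x i = true)
  rw [Finset.card_univ, Fintype.card_fin] at this
  omega

theorem sum_bitString_apply_card {n : ℕ} (g : ℕ → ℝ) :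
    ∑ x : Fin n → Bool, g (Finset.univ.filter fun i => x i = true).card =
      ∑ k ∈ Finset.range (n + 1), g k * n.choose k := by
  have h := Finset.sum_powerset_apply_card g (x := (Finset.univ : Finset (Fin n)))
  rw [Finset.card_univ, Fintype.card_fin, Finset.powerset_univ] at h
  simp only [nsmul_eq_mul, mul_comm (Nat.cast _)] at h
  rw [← h]
  let e : (Fin n → Bool) ≃ Finset (Fin n) :=
    { toFun := fun x => Finset.univ.filter fun i => x i = true
      invFun := fun S i => decide (i ∈ S)
      left_inv := fun x => by ext i; simp
      right_inv := fun S => by ext i; simp }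
  exact e.sum_comp fun S => g S.card

/-- The measurement of one transmitted pair that detects the component `Q true`. -/
def detector {a b : Type} [DecidableEq a] [DecidableEq b] (Q : Bool → Op (a × b)) (k : Bool) : Op (a × b) :=
  if k then Q true else 1 - Q true

/-- The operators of the measurement that applies `detector` to each of the stored pairs. -/
def detectorString {a b : Type} [DecidableEq a]
    [DecidableEq b] (Q : Bool → Op (a × b)) {n : ℕ} (x : Fin n → Bool) :
    Op (BellReg a b n × a) :=
  storedOp (piOp fun i => detector Q (x i)) 1

theorem sum_detectorString {a b : Type} [DecidableEq a] [DecidableEq b] (Q : Bool → Op (a × b)) (n : ℕ) :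
    ∑ x : Fin n → Bool, detectorString Q x = 1 := by
  have h := piOp_sum_smul (n := n) (fun _ => 1) (detector Q)
  simp only [Finset.prod_const_one] at h
  have h1 : ∑ k, (1 : ℂ) • detector Q k = 1 := by
    simp [detector]
  rw [h1, piOp_one] at h
  rw [← storedOp_one, h, storedOp_sum_smul]
  simp only [one_smul, detectorString]

section Mixture

variable {a b : Type} [Fintype a] [DecidableEq a] [Fintype b]
  {A B : Op a →ₗ[ℂ] Op b} {Q : Bool → Op (a × b)} {c : ℝ}

namespace HaveOrthogonalChoi

theorem choi_mixture (h : HaveOrthogonalChoi A B Q c) (q : ℝ) :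
    choi (((1 - q : ℝ) : ℂ) • A + (q : ℂ) • B) =
      ∑ k, (projectionWeight c q k : ℂ) • Q k := by
  rw [choi, ampliate_combination]
  change ((1 - q : ℝ) : ℂ) • choi A + (q : ℂ) • choi B = _
  rw [h.choi_left, h.choi_right, Fintype.sum_bool, smul_smul, ← Complex.ofReal_mul, add_comm]
  simp [projectionWeight]

theorem projection_posSemidef (h : HaveOrthogonalChoi A B Q c) (k : Bool) :
    (Q k).PosSemidef := by
  have := Matrix.posSemidef_self_mul_conjTranspose (Q k)
  rwa [show (Q k).conjTranspose = Q k from h.isHermitian k, h.mul_eq, if_pos rfl] at this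

theorem detector_posSemidef [DecidableEq b] (h : HaveOrthogonalChoi A B Q c) (k : Bool) :
    (detector Q k).PosSemidef := by
  cases k
  · have e : detector Q false = (1 - Q true) * (1 - Q true).conjTranspose := by
      rw [Matrix.conjTranspose_sub, Matrix.conjTranspose_one,
        show (Q true).conjTranspose = Q true from h.isHermitian true, mul_sub, mul_one, sub_mul,
        one_mul, h.mul_eq, if_pos rfl, sub_self, sub_zero]
      rfl
    rw [e]
    exact Matrix.posSemidef_self_mul_conjTranspose _
  · exact h.projection_posSemidef true

theorem detectorString_posSemidef [DecidableEq b] (h : HaveOrthogonalChoi A B Q c) {n : ℕ}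
    (x : Fin n → Bool) :
    (detectorString Q x).PosSemidef :=
  storedOp_posSemidef (piOp_posSemidef fun i => h.detector_posSemidef (x i)) .one

theorem projectionWeight_nonneg (h : HaveOrthogonalChoi A B Q c) {q : ℝ}
    (hq : q ∈ Set.Icc (0 : ℝ) 1) (k : Bool) : 0 ≤ projectionWeight c q k := by
  cases k
  · simpa [projectionWeight] using hq.2
  · simpa [projectionWeight] using mul_nonneg hq.1 h.nonneg

variable [Nonempty a]

theorem trace_left (h : HaveOrthogonalChoi A B Q c) : (Q false).trace = 1 := by
  rw [← h.choi_left, choi, h.isChannel_left.ampliate_trace, bell_trace]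

theorem trace_right (h : HaveOrthogonalChoi A B Q c) : (c : ℂ) * (Q true).trace = 1 := by
  rw [← smul_eq_mul, ← Matrix.trace_smul, ← h.choi_right, choi, h.isChannel_right.ampliate_trace,
    bell_trace]

theorem trace_right_re (h : HaveOrthogonalChoi A B Q c) : c * (Q true).trace.re = 1 := by
  rw [← trace_ofReal_smul_re, Matrix.trace_smul, smul_eq_mul, h.trace_right, Complex.one_re]

theorem sum_sqrt_projectionWeight (h : HaveOrthogonalChoi A B Q c) {p q : ℝ}
    (hp : p ∈ Set.Icc (0 : ℝ) 1) (hq : q ∈ Set.Icc (0 : ℝ) 1) :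
    ∑ k, √(projectionWeight c p k * projectionWeight c q k) * (Q k).trace.re =
      bernoulliFidelity p q := by
  rw [Fintype.sum_bool, h.trace_left]
  have e : √(p * c * (q * c)) = √(p * q) * c := by
    rw [show p * c * (q * c) = p * q * c ^ 2 by ring, Real.sqrt_mul (mul_nonneg hp.1 hq.1),
      Real.sqrt_sq h.nonneg]
  simp only [projectionWeight, if_true, Bool.false_eq_true, if_false, e, Complex.one_re, mul_one]
  rw [mul_assoc, h.trace_right_re, mul_one, bernoulliFidelity, add_comm]

variable [DecidableEq b]

theorem fidelity_choi (h : HaveOrthogonalChoi A B Q c) {p q : ℝ}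
    (hp : p ∈ Set.Icc (0 : ℝ) 1) (hq : q ∈ Set.Icc (0 : ℝ) 1) :
    fidelity (choi (((1 - p : ℝ) : ℂ) • A + (p : ℂ) • B))
      (choi (((1 - q : ℝ) : ℂ) • A + (q : ℂ) • B)) = bernoulliFidelity p q := by
  rw [h.choi_mixture, h.choi_mixture, fidelity_sum_smul_projection Q h.isHermitian h.mul_eq _ _
    (h.projectionWeight_nonneg hp) (h.projectionWeight_nonneg hq),
    h.sum_sqrt_projectionWeight hp hq]

theorem fidelity_bellProtocol (h : HaveOrthogonalChoi A B Q c) (n : ℕ) {p q : ℝ}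
    (hp : p ∈ Set.Icc (0 : ℝ) 1) (hq : q ∈ Set.Icc (0 : ℝ) 1) :
    fidelity ((bellProtocol a b).state (((1 - p : ℝ) : ℂ) • A + (p : ℂ) • B) n)
      ((bellProtocol a b).state (((1 - q : ℝ) : ℂ) • A + (q : ℂ) • B) n) =
        bernoulliFidelity p q ^ n := by
  rw [bellProtocol_state, bellProtocol_state, h.choi_mixture, h.choi_mixture,
    ← h.sum_sqrt_projectionWeight hp hq]
  exact fidelity_storedOp Q h.isHermitian h.mul_eq _ _
    (h.projectionWeight_nonneg hp) (h.projectionWeight_nonneg hq)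

theorem trace_choi_mul_detector (h : HaveOrthogonalChoi A B Q c) (q : ℝ) (k : Bool) :
    (choi (((1 - q : ℝ) : ℂ) • A + (q : ℂ) • B) * detector Q k).trace = bitWeight q k := by
  have h1 : (choi (((1 - q : ℝ) : ℂ) • A + (q : ℂ) • B) * Q true).trace = q := by
    rw [h.choi_mixture, Fintype.sum_bool, add_mul, Matrix.smul_mul, Matrix.smul_mul, h.mul_eq,
      h.mul_eq, if_pos rfl, if_neg Bool.false_ne_true, smul_zero, add_zero, Matrix.trace_smul,
      projectionWeight, if_pos rfl, Complex.ofReal_mul, smul_eq_mul, mul_assoc, h.trace_right,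
      mul_one]
  have h2 : (choi (((1 - q : ℝ) : ℂ) • A + (q : ℂ) • B)).trace = 1 := by
    rw [h.choi_mixture, Fintype.sum_bool, Matrix.trace_add, Matrix.trace_smul, Matrix.trace_smul,
      h.trace_left]
    simp only [projectionWeight, if_true, Bool.false_eq_true, if_false, smul_eq_mul, mul_one,
      Complex.ofReal_mul, mul_assoc, h.trace_right]
    push_cast
    ring
  cases k
  · simp only [detector, bitWeight, Bool.false_eq_true, if_false]
    rw [mul_sub, mul_one, Matrix.trace_sub, h1, h2]
    push_cast
    rfl
  · simpa [detector, bitWeight] using h1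

theorem trace_mul_detectorString (h : HaveOrthogonalChoi A B Q c) (q : ℝ) {n : ℕ}
    (x : Fin n → Bool) :
    (storedOp (n := n) (piOp fun _ => choi (((1 - q : ℝ) : ℂ) • A + (q : ℂ) • B)) (bell a) *
      detectorString Q x).trace.re =
        stringWeight q n (Finset.univ.filter fun i => x i = true).card := by
  rw [detectorString, storedOp_mul, storedOp_trace, mul_one, bell_trace, mul_one, piOp_mul,
    piOp_trace]
  simp only [h.trace_choi_mul_detector]
  rw [← Complex.ofReal_prod, Complex.ofReal_re, prod_bitWeight]

/-- The estimator that reports the relative frequency of the outcome `Q true` (for `n = 0` it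
reports `0 / 0 = 0`). -/
def frequencyEstimator (h : HaveOrthogonalChoi A B Q c) (n : ℕ) :
    EstimatorPOVM (BellReg a b n × a) :=
  finitePOVM (detectorString Q) h.detectorString_posSemidef (sum_detectorString Q n)
    fun x => (Finset.univ.filter fun i => x i = true).card / (n : ℝ)

theorem frequencyEstimator_law (h : HaveOrthogonalChoi A B Q c) (n : ℕ) {q : ℝ}
    (hq : q ∈ Set.Icc (0 : ℝ) 1) :
    (h.frequencyEstimator n).law
        (storedOp (piOp fun _ => choi (((1 - q : ℝ) : ℂ) • A + (q : ℂ) • B)) (bell a)) =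
      ∑ x : Fin n → Bool,
        ENNReal.ofReal (stringWeight q n (Finset.univ.filter fun i => x i = true).card) •
          Measure.dirac ((Finset.univ.filter fun i => x i = true).card / (n : ℝ)) := by
  rw [frequencyEstimator, finitePOVM_law]
  · simp only [h.trace_mul_detectorString]
  · refine storedOp_posSemidef (piOp_posSemidef fun _ => ?_) (bell_posSemidef a)
    rw [h.choi_mixture]
    exact Matrix.posSemidef_sum _ fun k _ => posSemidef_ofReal_smul (h.projection_posSemidef k)
      (h.projectionWeight_nonneg hq k)

theorem frequencyEstimator_integrable (h : HaveOrthogonalChoi A B Q c) (n : ℕ) {q : ℝ}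
    (hq : q ∈ Set.Icc (0 : ℝ) 1) :
    Integrable (fun x : ℝ => x) ((h.frequencyEstimator n).law
        (storedOp (piOp fun _ => choi (((1 - q : ℝ) : ℂ) • A + (q : ℂ) • B)) (bell a))) := by
  rw [h.frequencyEstimator_law n hq]
  exact integrable_finsetSum_measure.mpr fun x _ =>
    (integrable_dirac (by simp)).smul_measure ENNReal.ofReal_ne_top

theorem frequencyEstimator_mean (h : HaveOrthogonalChoi A B Q c) {n : ℕ} (hn : 1 ≤ n) {q : ℝ}
    (hq : q ∈ Set.Icc (0 : ℝ) 1) :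
    ∫ x, x ∂((h.frequencyEstimator n).law
        (storedOp (piOp fun _ => choi (((1 - q : ℝ) : ℂ) • A + (q : ℂ) • B)) (bell a))) = q := by
  have hn0 : (n : ℝ) ≠ 0 := by positivity
  rw [h.frequencyEstimator_law n hq, integral_finsetSum_measure fun x _ =>
    (integrable_dirac (by simp)).smul_measure ENNReal.ofReal_ne_top]
  simp only [integral_smul_measure, integral_dirac, smul_eq_mul,
    ENNReal.toReal_ofReal (stringWeight_nonneg hq n _)]
  rw [sum_bitString_apply_card (fun k => stringWeight q n k * (k / n))]
  have h1 := sum_stringWeight_mul_sub_mul_choose q n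
  have h0 := sum_stringWeight_mul_choose q n
  calc _ = 1 / n * ∑ k ∈ Finset.range (n + 1), stringWeight q n k * (k - n * q) * n.choose k +
        q * ∑ k ∈ Finset.range (n + 1), stringWeight q n k * n.choose k := by
        rw [Finset.mul_sum, Finset.mul_sum, ← Finset.sum_add_distrib]
        refine Finset.sum_congr rfl fun k _ => ?_
        field_simp
        ring
    _ = q := by rw [h1, h0]; ring

theorem frequencyEstimator_variance (h : HaveOrthogonalChoi A B Q c) {n : ℕ} (hn : 1 ≤ n) {q : ℝ}
    (hq : q ∈ Set.Icc (0 : ℝ) 1) :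
    estimatorVariance (h.frequencyEstimator n)
        (storedOp (piOp fun _ => choi (((1 - q : ℝ) : ℂ) • A + (q : ℂ) • B)) (bell a)) =
      ENNReal.ofReal (q * (1 - q) / n) := by
  have hn0 : (n : ℝ) ≠ 0 := by positivity
  rw [estimatorVariance, evariance_eq_lintegral_ofReal, h.frequencyEstimator_mean hn hq,
    h.frequencyEstimator_law n hq, lintegral_finsetSum_measure]
  simp only [lintegral_smul_measure, lintegral_dirac, smul_eq_mul]
  simp only [← ENNReal.ofReal_mul (stringWeight_nonneg hq n _)]
  rw [← ENNReal.ofReal_sum_of_nonneg fun x _ =>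
    mul_nonneg (stringWeight_nonneg hq n _) (sq_nonneg _),
    sum_bitString_apply_card (fun k => stringWeight q n k * (k / n - q) ^ 2)]
  congr 1
  have h2 := sum_stringWeight_mul_sub_sq_mul_choose q n
  calc _ = 1 / n ^ 2 *
        ∑ k ∈ Finset.range (n + 1), stringWeight q n k * (k - n * q) ^ 2 * n.choose k := by
        rw [Finset.mul_sum]
        refine Finset.sum_congr rfl fun k _ => ?_
        field_simp
    _ = q * (1 - q) / n := by
        rw [h2]
        field_simp

theorem hasQFI_bellProtocol (h : HaveOrthogonalChoi A B Q c) (n : ℕ) {p : ℝ}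
    (hp : p ∈ Set.Ioo (0 : ℝ) 1) :
    HasQFI (fun q => (bellProtocol a b).state (((1 - q : ℝ) : ℂ) • A + (q : ℂ) • B) n) p
      (n / (p * (1 - p))) := by
  refine (tendsto_bernoulliFidelity_pow_quotient hp n).congr' ?_
  filter_upwards [eventually_add_mem_Icc hp] with δ hδ
  rw [fisherQuotient, h.fidelity_bellProtocol n (Set.Ioo_subset_Icc_self hp) hδ]

/-- The upper bounds hold because each use of the box can be simulated by one classical coin flip;
they are attained because the two Choi matrices can be told apart without error. -/
theorem obeysAdaptiveLimit (h : HaveOrthogonalChoi A B Q c) {E : ℝ → (Op a →ₗ[ℂ] Op b)}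
    (hE : ∀ q, E q = ((1 - q : ℝ) : ℂ) • A + (q : ℂ) • B) : ObeysAdaptiveLimit E := by
  obtain rfl : E = fun q : ℝ => ((1 - q : ℝ) : ℂ) • A + (q : ℂ) • B := funext hE
  refine ⟨fun p hp => ?_, fun p hp n => ?_, fun p hp n => h.hasQFI_bellProtocol n hp,
    fun p hp n hn P M hM => ?_, h.frequencyEstimator, fun p hp => ⟨fun n hn => ?_, ?_⟩⟩
  · refine (tendsto_bernoulliFidelity_quotient hp).congr' ?_
    filter_upwards [eventually_add_mem_Icc hp] with δ hδ
    rw [fisherQuotient, h.fidelity_choi (Set.Ioo_subset_Icc_self hp) hδ]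
  · refine le_antisymm
      (iSup_le fun P => qfi_state_le P h.isChannel_left h.isChannel_right n hp) ?_
    rw [← (h.hasQFI_bellProtocol n hp).qfi_eq]
    exact le_iSup (fun P : AdaptiveProtocol a b =>
      qfi (fun q : ℝ => P.state (((1 - q : ℝ) : ℂ) • A + (q : ℂ) • B) n) p) (bellProtocol a b)
  · simp only [P.state_eq_sum_component] at hM ⊢
    exact ofReal_le_estimatorVariance M hn _
      (P.component_posSemidef h.isChannel_left h.isChannel_right n)
      (P.component_trace h.isChannel_left h.isChannel_right n) hp hM
  · filter_upwards [Icc_mem_nhds hp.1 hp.2] with q hq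
    rw [bellProtocol_state]
    exact ⟨h.frequencyEstimator_integrable n hq, h.frequencyEstimator_mean hn hq⟩
  · refine tendsto_const_nhds.congr' ?_
    filter_upwards [eventually_ge_atTop 1] with n hn
    have hn0 : (n : ℝ) ≠ 0 := by positivity
    have hv := h.frequencyEstimator_variance hn (Set.Ioo_subset_Icc_self hp)
    rw [bellProtocol_state]
    refine Eq.trans ?_ (congrArg (fun v => (n : ℝ≥0∞) * v) hv.symm)
    rw [← ENNReal.ofReal_natCast, ← ENNReal.ofReal_mul (Nat.cast_nonneg n), mul_div_cancel₀ _ hn0]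

end HaveOrthogonalChoi

end Mixture

/-! ### Conjugation channels -/

theorem conjMap_apply {a b : Type} [Fintype a] (K : Matrix b a ℂ) (X : Op a) :
    conjMap K X = K * X * K.conjTranspose := rfl

theorem ampliate_conjMap {R a b : Type} [Fintype R] [DecidableEq R] [Fintype a]
    (K : Matrix b a ℂ) (X : Op (R × a)) :
    ampliate R (conjMap K) X = conjMap ((1 : Op R) ⊗ₖ K) X := by
  ext ⟨r, i⟩ ⟨r', i'⟩
  simp only [ampliate_apply, conjMap_apply, Matrix.mul_apply, Matrix.of_apply,
    Matrix.conjTranspose_apply, Matrix.kroneckerMap_apply, Fintype.sum_prod_type, Matrix.one_apply,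
    ite_mul, one_mul, zero_mul, star_zero, mul_ite, mul_zero, Finset.sum_ite_irrel,
    Finset.sum_const_zero, Finset.sum_ite_eq, Finset.mem_univ, if_true, apply_ite star]

theorem choi_conjMap {a b : Type} [Fintype a] [DecidableEq a] (K : Matrix b a ℂ) :
    choi (conjMap K) = conjMap ((1 : Op a) ⊗ₖ K) (bell a) :=
  ampliate_conjMap K (bell a)

theorem conjMap_isChannel {a b : Type} [Fintype a] [DecidableEq a] [Fintype b]
    {K : Matrix b a ℂ} (hK : K.conjTranspose * K = 1) : IsChannel (conjMap K) where
  completelyPositive k X hX := by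
    rw [ampliate_conjMap, conjMap_apply]
    exact hX.mul_mul_conjTranspose_same _
  tracePreserving X := by
    rw [conjMap_apply, Matrix.trace_mul_comm, ← Matrix.mul_assoc, hK, Matrix.one_mul]

theorem isChannel_sum_smul {a b ι : Type} [Fintype a] [Fintype b] [Fintype ι]
    {E : ι → (Op a →ₗ[ℂ] Op b)} (hE : ∀ k, IsChannel (E k)) {p : ι → ℝ} (hp : ∀ k, 0 ≤ p k)
    (hp1 : ∑ k, p k = 1) : IsChannel (∑ k, (p k : ℂ) • E k) where
  completelyPositive r X hX := by
    have h : ampliate (Fin r) (∑ k, (p k : ℂ) • E k) X =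
        ∑ k, (p k : ℂ) • ampliate (Fin r) (E k) X := by
      ext x y
      simp [ampliate_apply, Matrix.sum_apply]
    rw [h]
    exact Matrix.posSemidef_sum _ fun k _ =>
      posSemidef_ofReal_smul ((hE k).completelyPositive r X hX) (hp k)
  tracePreserving X := by
    simp only [LinearMap.sum_apply, LinearMap.smul_apply, Matrix.trace_sum, Matrix.trace_smul,
      (hE _).tracePreserving, smul_eq_mul, ← Finset.sum_mul]
    rw [← Complex.ofReal_sum, hp1, Complex.ofReal_one, one_mul]

/-! ### Generalized Pauli channels -/

section Pauli

variable (d : ℕ) [NeZero d]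

theorem shiftOp_pow_apply (s : ℕ) (i j : ZMod d) :
    (shiftOp d ^ s) i j = if i = j + s then 1 else 0 := by
  induction s generalizing i with
  | zero => simp [Matrix.one_apply]
  | succ s ih =>
    have h1 : ∀ i j : ZMod d, shiftOp d i j = if i = j + 1 then 1 else 0 := fun _ _ => rfl
    rw [pow_succ', Matrix.mul_apply]
    simp only [ih, mul_ite, mul_one, mul_zero, Finset.sum_ite_eq', Finset.mem_univ, if_true, h1]
    rw [Nat.cast_succ, add_assoc]

theorem pauliOp_apply (k : ZMod d × ZMod d) (i j : ZMod d) :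
    pauliOp d k i j = if i = j + k.1 then ZMod.stdAddChar (j * k.2) else 0 := by
  have hchar : ∀ j : ZMod d, Complex.exp (2 * Real.pi * Complex.I * (j.val : ℂ) / (d : ℂ)) =
      ZMod.stdAddChar j := fun j => by
    rw [ZMod.stdAddChar_apply, ZMod.toCircle_apply]
  rw [pauliOp, clockOp, Matrix.diagonal_pow, Matrix.mul_diagonal, shiftOp_pow_apply, Pi.pow_apply,
    hchar, ← AddChar.map_nsmul_eq_pow, nsmul_eq_mul, ZMod.natCast_zmod_val, ZMod.natCast_zmod_val,
    mul_comm k.2]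
  split_ifs <;> simp

theorem sum_star_pauliOp_mul (k l : ZMod d × ZMod d) (j j' : ZMod d) :
    ∑ i, star (pauliOp d k i j) * pauliOp d l i j' =
      if j + k.1 = j' + l.1 then ZMod.stdAddChar (j' * l.2 - j * k.2) else 0 := by
  simp only [pauliOp_apply, apply_ite star, star_zero, ite_mul, zero_mul, Finset.sum_ite_eq',
    Finset.mem_univ, if_true, mul_ite, mul_zero]
  simp only [eq_comm (a := j' + l.1)]
  split_ifs
  · rw [sub_eq_neg_add, AddChar.map_add_eq_mul, AddChar.map_neg_eq_conj]
    rfl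
  · rfl

theorem pauliOp_conjTranspose_mul_self (k : ZMod d × ZMod d) :
    (pauliOp d k).conjTranspose * pauliOp d k = 1 := by
  ext j j'
  simp only [Matrix.mul_apply, Matrix.conjTranspose_apply, sum_star_pauliOp_mul, add_left_inj,
    Matrix.one_apply]
  split_ifs with h
  · rw [h, sub_self, AddChar.map_zero_eq_one]
  · rfl

theorem pauliChannel_isChannel {p : ZMod d × ZMod d → ℝ} (hp : ∀ k, 0 ≤ p k)
    (hp1 : ∑ k, p k = 1) : IsChannel (pauliChannel d p) :=
  isChannel_sum_smul (fun k => conjMap_isChannel (pauliOp_conjTranspose_mul_self d k)) hp hp1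

theorem choi_pauliChannel (p : ZMod d × ZMod d → ℝ) :
    choi (pauliChannel d p) = ∑ k, (p k : ℂ) • bellProjector d k := by
  simp only [bellProjector, ← choi_conjMap]
  ext x y
  simp [choi, pauliChannel, ampliate_apply, Matrix.sum_apply]

/-- The generalized Bell vectors `(I ⊗ Pₖ) |Φ⟩`. -/
def pauliBellVector (k : ZMod d × ZMod d) : ZMod d × ZMod d → ℂ :=
  ((1 : Op (ZMod d)) ⊗ₖ pauliOp d k).mulVec (bellVector (ZMod d))

theorem pauliBellVector_apply (k : ZMod d × ZMod d) (x : ZMod d × ZMod d) :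
    pauliBellVector d k x = pauliOp d k x.2 x.1 * (((√(d : ℝ))⁻¹ : ℝ) : ℂ) := by
  simp only [pauliBellVector, Matrix.mulVec, dotProduct, Matrix.kroneckerMap_apply, bellVector,
    Fintype.sum_prod_type, Matrix.one_apply, ite_mul, one_mul, zero_mul, mul_ite, mul_zero,
    Finset.sum_ite_eq, Finset.mem_univ, if_true, ZMod.card]

theorem pauliBellVector_orthonormal (k l : ZMod d × ZMod d) :
    star (pauliBellVector d k) ⬝ᵥ pauliBellVector d l = if k = l then 1 else 0 := by
  have hd : (d : ℂ) ≠ 0 := Nat.cast_ne_zero.mpr (NeZero.ne d)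
  have hc : (((√(d : ℝ))⁻¹ : ℝ) : ℂ) * (((√(d : ℝ))⁻¹ : ℝ) : ℂ) = (d : ℂ)⁻¹ := by
    rw [← Complex.ofReal_mul, ← mul_inv, Real.mul_self_sqrt (Nat.cast_nonneg d)]
    simp
  calc star (pauliBellVector d k) ⬝ᵥ pauliBellVector d l
      = (d : ℂ)⁻¹ * ∑ j, ∑ i, star (pauliOp d k i j) * pauliOp d l i j := by
        simp only [dotProduct, Pi.star_apply, pauliBellVector_apply, Fintype.sum_prod_type,
          star_mul', Finset.mul_sum, ← hc]
        refine Finset.sum_congr rfl fun j _ => Finset.sum_congr rfl fun i _ => ?_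
        rw [show star (((√(d : ℝ))⁻¹ : ℝ) : ℂ) = (((√(d : ℝ))⁻¹ : ℝ) : ℂ) from
          Complex.conj_ofReal _]
        ring
    _ = if k = l then 1 else 0 := by
        simp only [sum_star_pauliOp_mul, add_right_inj, ← mul_sub]
        by_cases h1 : k.1 = l.1
        · simp only [if_pos h1]
          rw [AddChar.sum_mulShift _ (ZMod.isPrimitive_stdAddChar d), ZMod.card]
          by_cases h2 : k.2 = l.2
          · rw [if_pos (sub_eq_zero.mpr h2.symm), if_pos (Prod.ext h1 h2), inv_mul_cancel₀ hd]
          · rw [if_neg (sub_ne_zero.mpr (Ne.symm h2)), if_neg fun h => h2 (congrArg Prod.snd h)]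
            simp
        · simp only [if_neg h1]
          rw [if_neg fun h => h1 (congrArg Prod.fst h)]
          simp

theorem bellProjector_eq (k : ZMod d × ZMod d) :
    bellProjector d k =
      Matrix.vecMulVec (pauliBellVector d k) (star (pauliBellVector d k)) := by
  rw [bellProjector, conjMap_apply, bell, Matrix.mul_vecMulVec, Matrix.vecMulVec_mul,
    ← Matrix.star_mulVec, pauliBellVector]

theorem bellProjector_mul (k l : ZMod d × ZMod d) :
    bellProjector d k * bellProjector d l = if k = l then bellProjector d k else 0 := by
  rw [bellProjector_eq, bellProjector_eq, Matrix.vecMulVec_mul_vecMulVec,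
    pauliBellVector_orthonormal]
  split_ifs with h
  · rw [h, one_smul]
  · rw [zero_smul, Matrix.vecMulVec_zero]

theorem bellProjector_isHermitian (k : ZMod d × ZMod d) : (bellProjector d k).IsHermitian := by
  rw [bellProjector_eq]
  exact (Matrix.posSemidef_vecMulVec_self_star _).isHermitian

theorem bellProjector_trace (k : ZMod d × ZMod d) : (bellProjector d k).trace = 1 := by
  rw [bellProjector_eq, Matrix.trace_vecMulVec, dotProduct_comm, pauliBellVector_orthonormal,
    if_pos rfl]

theorem fidelity_choi_pauliChannel {p q : ZMod d × ZMod d → ℝ} (hp : ∀ k, 0 ≤ p k)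
    (hq : ∀ k, 0 ≤ q k) :
    fidelity (choi (pauliChannel d p)) (choi (pauliChannel d q)) = ∑ k, √(p k * q k) := by
  rw [choi_pauliChannel, choi_pauliChannel, fidelity_sum_smul_projection _
    (bellProjector_isHermitian d) (bellProjector_mul d) p q hp hq]
  simp [bellProjector_trace]

theorem fidelity_choi_pauliChannel_expansion {p : ZMod d × ZMod d → ℝ} (hp : ∀ k, 0 ≤ p k)
    (hp1 : ∑ k, p k = 1) :
    (fun δ : ZMod d × ZMod d → ℝ =>
        fidelity (choi (pauliChannel d p)) (choi (pauliChannel d (p + δ))) -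
          (1 - 1 / 8 * ∑ k, δ k ^ 2 / p k))
      =o[𝓝[{δ | ∑ k, δ k = 0 ∧ ∀ k, p k = 0 → δ k = 0}] 0] fun δ => ‖δ‖ ^ 2 := by
  set l : Filter (ZMod d × ZMod d → ℝ) :=
    𝓝[{δ | ∑ k, δ k = 0 ∧ ∀ k, p k = 0 → δ k = 0}] 0 with hl
  have happ : ∀ k, Tendsto (fun δ : ZMod d × ZMod d → ℝ => δ k) l (𝓝 0) := fun k =>
    (Continuous.tendsto' (continuous_apply k) _ _ rfl).mono_left nhdsWithin_le_nhds
  have hterm : ∀ k, (fun δ : ZMod d × ZMod d → ℝ =>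
      √(p k * (p k + δ k)) - (p k + δ k / 2 - 1 / 8 * (δ k ^ 2 / p k))) =o[l]
        fun δ => ‖δ‖ ^ 2 := by
    intro k
    rcases (hp k).eq_or_lt with h | h
    · refine (Asymptotics.isLittleO_zero _ _).congr' ?_ EventuallyEq.rfl
      filter_upwards [self_mem_nhdsWithin] with δ hδ
      simp [← h, hδ.2 k h.symm]
    · refine ((sqrt_mul_add_isLittleO h).comp_tendsto (happ k)).trans_isBigO ?_
      refine Asymptotics.IsBigO.of_bound 1 (Eventually.of_forall fun δ => ?_)
      simp only [Function.comp_apply, norm_pow, norm_norm, one_mul]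
      exact pow_le_pow_left₀ (norm_nonneg _) (norm_le_pi_norm δ k) 2
  have hsum := Asymptotics.IsLittleO.sum (s := Finset.univ) fun k _ => hterm k
  refine hsum.congr' ?_ EventuallyEq.rfl
  have hev : ∀ᶠ δ in l, ∀ k, 0 ≤ p k + δ k := by
    refine eventually_all.mpr fun k => ?_
    rcases (hp k).eq_or_lt with h | h
    · filter_upwards [self_mem_nhdsWithin] with δ hδ
      rw [← h, hδ.2 k h.symm, add_zero]
    · filter_upwards [(happ k).eventually (eventually_ge_nhds (neg_lt_zero.mpr h))] with δ hδ
      linarith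
  filter_upwards [hev, self_mem_nhdsWithin] with δ hδ hδ0
  rw [fidelity_choi_pauliChannel d hp (q := p + δ) hδ, Finset.sum_apply]
  simp only [Finset.sum_sub_distrib, Finset.sum_add_distrib, ← Finset.mul_sum,
    ← Finset.sum_div, hp1, hδ0.1, Pi.add_apply]
  ring

/-- A Pauli channel that makes no error with probability `1 - p`, and otherwise one of the errors
in `S`, all equally likely. -/
theorem haveOrthogonalChoi_pauliChannel (S : Finset (ZMod d × ZMod d)) (hS : S.Nonempty)
    (h0 : 0 ∉ S) :
    HaveOrthogonalChoi (pauliChannel d fun k => if k = 0 then 1 else 0)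
      (pauliChannel d fun k => if k ∈ S then (S.card : ℝ)⁻¹ else 0)
      (fun k => if k then ∑ l ∈ S, bellProjector d l else bellProjector d 0)
      (S.card : ℝ)⁻¹ where
  isChannel_left := pauliChannel_isChannel d (fun k => by split_ifs <;> simp) (by simp)
  isChannel_right := pauliChannel_isChannel d (fun k => by split_ifs <;> simp) (by
    have : (S.card : ℝ) ≠ 0 := Nat.cast_ne_zero.mpr hS.card_pos.ne'
    simp [this])
  isHermitian k := by
    cases k
    · exact bellProjector_isHermitian d 0
    · change (∑ l ∈ S, bellProjector d l).conjTranspose = _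
      rw [Matrix.conjTranspose_sum]
      exact Finset.sum_congr rfl fun l _ => bellProjector_isHermitian d l
  mul_eq k l := by
    cases k <;> cases l
    · simpa using bellProjector_mul d 0 0
    · simp [Finset.mul_sum, bellProjector_mul, h0]
    · simp only [if_true, Bool.false_eq_true, if_false, Finset.sum_mul, bellProjector_mul,
        Bool.true_eq_false]
      exact Finset.sum_eq_zero fun l hl => if_neg (by rintro rfl; exact h0 hl)
    · simp only [if_true, Finset.sum_mul, Finset.mul_sum, bellProjector_mul]
      refine Finset.sum_congr rfl fun k hk => ?_
      rw [Finset.sum_ite_eq', if_pos hk]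
  choi_left := by
    rw [choi_pauliChannel, Finset.sum_eq_single 0]
    · simp
    · intro k _ hk
      simp [hk]
    · simp
  choi_right := by
    rw [choi_pauliChannel]
    simp only [if_true, Finset.smul_sum, apply_ite Complex.ofReal, Complex.ofReal_zero, ite_smul,
      zero_smul, Finset.sum_ite_mem, Finset.univ_inter]
  nonneg := by positivity

theorem obeysAdaptiveLimit_pauliChannel (S : Finset (ZMod d × ZMod d)) (hS : S.Nonempty)
    (h0 : 0 ∉ S) :
    ObeysAdaptiveLimit fun p : ℝ => pauliChannel d fun k =>
      if k = 0 then 1 - p else if k ∈ S then p / S.card else 0 := by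
  refine (haveOrthogonalChoi_pauliChannel d S hS h0).obeysAdaptiveLimit fun q => ?_
  simp only [pauliChannel, Finset.smul_sum, ← Finset.sum_add_distrib, smul_smul, ← add_smul]
  refine Finset.sum_congr rfl fun k _ => ?_
  congr 1
  by_cases hk : k = 0
  · subst hk
    simp [h0]
  · by_cases hkS : k ∈ S <;> simp [hk, hkS, div_eq_mul_inv]

end Pauli

theorem obeysAdaptiveLimit_depolarizing : ObeysAdaptiveLimit depolarizing := by
  have h := obeysAdaptiveLimit_pauliChannel 2 {0}ᶜ ⟨(1, 0), by decide⟩ (by simp)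
  convert h using 1
  funext p
  rw [depolarizing]
  congr 1
  funext k
  by_cases hk : k = 0
  · simp [hk]
  · have hc : (({0}ᶜ : Finset (ZMod 2 × ZMod 2))).card = 3 := by decide
    rw [if_neg hk, if_neg hk, if_pos (by simpa using hk), hc]
    norm_num

theorem obeysAdaptiveLimit_dephasing : ObeysAdaptiveLimit dephasing := by
  have h := obeysAdaptiveLimit_pauliChannel 2 {(0, 1)} (by simp) (by decide)
  convert h using 1
  funext p
  rw [dephasing]
  congr 1
  funext k
  simp

/-! ### Erasure channels -/

section Erasure

theorem erasureState_isHermitian (d : ℕ) : (erasureState d).IsHermitian := by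
  rw [Matrix.IsHermitian, erasureState, Matrix.conjTranspose_single, star_one]

variable (d : ℕ) [NeZero d]

theorem embedOp_conjTranspose_mul_self : (embedOp d).conjTranspose * embedOp d = 1 := by
  ext i j
  simp [embedOp, Matrix.mul_apply, Matrix.one_apply, eq_comm]

theorem erasureState_mul_embedOp : erasureState d * embedOp d = 0 := by
  ext i j
  simp [erasureState, embedOp, Matrix.mul_apply, Matrix.single_apply]

theorem erasureState_mul_self : erasureState d * erasureState d = erasureState d := by
  rw [erasureState, Matrix.single_mul_single_same, one_mul]

theorem erasureState_posSemidef : (erasureState d).PosSemidef := by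
  have := Matrix.posSemidef_self_mul_conjTranspose (erasureState d)
  rwa [show (erasureState d).conjTranspose = erasureState d from erasureState_isHermitian d,
    erasureState_mul_self] at this

/-- The channel `ρ ↦ Tr(ρ) |e⟩⟨e|`. -/
def fullErasure : Op (ZMod d) →ₗ[ℂ] Op (Option (ZMod d)) :=
  (Matrix.traceLinearMap (ZMod d) ℂ ℂ).smulRight (erasureState d)

theorem fullErasure_isChannel : IsChannel (fullErasure d) where
  completelyPositive k X hX := by
    have h : ampliate (Fin k) (fullErasure d) X =
        ∑ u : ZMod d, X.submatrix (fun r => (r, u)) (fun r => (r, u)) ⊗ₖ erasureState d := by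
      ext x y
      simp [ampliate_apply, fullErasure, Matrix.sum_apply, Matrix.trace, Finset.sum_mul]
    rw [h]
    exact Matrix.posSemidef_sum _ fun u _ =>
      (hX.submatrix _).kronecker (erasureState_posSemidef d)
  tracePreserving X := by
    simp [fullErasure, erasureState]

theorem choi_fullErasure :
    choi (fullErasure d) = (((d : ℝ)⁻¹ : ℝ) : ℂ) • ((1 : Op (ZMod d)) ⊗ₖ erasureState d) := by
  have hc : (((√(d : ℝ))⁻¹ : ℝ) : ℂ) * (((√(d : ℝ))⁻¹ : ℝ) : ℂ) = (((d : ℝ)⁻¹ : ℝ) : ℂ) := by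
    rw [← Complex.ofReal_mul, ← mul_inv, Real.mul_self_sqrt (Nat.cast_nonneg d)]
  ext ⟨j, x⟩ ⟨j', x'⟩
  have h : (Matrix.of fun u v => bell (ZMod d) (j, u) (j', v)).trace =
      (((d : ℝ)⁻¹ : ℝ) : ℂ) * (1 : Op (ZMod d)) j j' := by
    simp only [Matrix.trace, Matrix.diag_apply, Matrix.of_apply, bell, Matrix.vecMulVec_apply,
      Pi.star_apply, bellVector, ZMod.card, apply_ite star, star_zero, RCLike.star_def,
      Complex.conj_ofReal, mul_ite, ite_mul, mul_zero, zero_mul, hc, Matrix.one_apply, mul_one]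
    by_cases hj : j = j'
    · subst hj
      simp
    · simp [hj]
  change (Matrix.of fun u v => bell (ZMod d) (j, u) (j', v)).trace * erasureState d x x' = _
  rw [h]
  simp [mul_assoc]

theorem haveOrthogonalChoi_erasure :
    HaveOrthogonalChoi (conjMap (embedOp d)) (fullErasure d)
      (fun k => if k then (1 : Op (ZMod d)) ⊗ₖ erasureState d else
        conjMap ((1 : Op (ZMod d)) ⊗ₖ embedOp d) (bell (ZMod d))) (d : ℝ)⁻¹ := by
  set K := (1 : Op (ZMod d)) ⊗ₖ embedOp d with hK
  set P := (1 : Op (ZMod d)) ⊗ₖ erasureState d with hP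
  have hKK : K.conjTranspose * K = 1 := by
    rw [hK, Matrix.conjTranspose_kronecker, ← Matrix.mul_kronecker_mul,
      embedOp_conjTranspose_mul_self, Matrix.conjTranspose_one, one_mul, Matrix.one_kronecker_one]
  have hPK : P * K = 0 := by
    rw [hK, hP, ← Matrix.mul_kronecker_mul, erasureState_mul_embedOp, Matrix.kronecker_zero]
  have hPH : P.conjTranspose = P := by
    rw [hP, Matrix.conjTranspose_kronecker, Matrix.conjTranspose_one,
      show (erasureState d).conjTranspose = erasureState d from erasureState_isHermitian d]
  have hKP : K.conjTranspose * P = 0 := by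
    rw [← hPH, ← Matrix.conjTranspose_mul, hPK, Matrix.conjTranspose_zero]
  refine ⟨conjMap_isChannel (embedOp_conjTranspose_mul_self d), fullErasure_isChannel d, ?_, ?_,
    choi_conjMap _, choi_fullErasure d, by positivity⟩
  · intro k
    cases k
    · exact ((bell_posSemidef (ZMod d)).mul_mul_conjTranspose_same K).isHermitian
    · exact hPH
  · intro k l
    cases k <;> cases l
    · simp only [Bool.false_eq_true, if_false, if_true, conjMap_apply]
      calc K * bell (ZMod d) * K.conjTranspose * (K * bell (ZMod d) * K.conjTranspose)
          = K * bell (ZMod d) * (K.conjTranspose * K) * bell (ZMod d) * K.conjTranspose := by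
            simp only [Matrix.mul_assoc]
        _ = K * bell (ZMod d) * K.conjTranspose := by
            rw [hKK, Matrix.mul_one, Matrix.mul_assoc K, bell_mul_bell]
    · simp only [Bool.false_eq_true, if_false, if_true, conjMap_apply]
      rw [Matrix.mul_assoc, hKP, Matrix.mul_zero]
    · simp only [Bool.false_eq_true, Bool.true_eq_false, if_false, if_true, conjMap_apply]
      rw [Matrix.mul_assoc K, ← Matrix.mul_assoc P, hPK, Matrix.zero_mul]
    · simp only [if_true]
      rw [hP, ← Matrix.mul_kronecker_mul, erasureState_mul_self, mul_one]

theorem erasure_eq (q : ℝ) :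
    erasure d q = ((1 - q : ℝ) : ℂ) • conjMap (embedOp d) + (q : ℂ) • fullErasure d := rfl

theorem choi_erasure (q : ℝ) : choi (erasure d q) =
    ((1 - q : ℝ) : ℂ) • conjMap ((1 : Op (ZMod d)) ⊗ₖ embedOp d) (bell (ZMod d)) +
      (q : ℂ) • (((d : ℂ)⁻¹ • (1 : Op (ZMod d))) ⊗ₖ erasureState d) := by
  rw [erasure_eq, choi, ampliate_combination]
  change ((1 - q : ℝ) : ℂ) • choi (conjMap (embedOp d)) + (q : ℂ) • choi (fullErasure d) = _
  rw [choi_conjMap, choi_fullErasure, Matrix.smul_kronecker]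
  push_cast
  rfl

end Erasure

end NoiseEstimation

end

open NoiseEstimation
theorem mainTheorem5 :
    -- depolarizing, dephasing and erasure channels
    ObeysAdaptiveLimit depolarizing ∧
    ObeysAdaptiveLimit dephasing ∧
    (∀ (d : ℕ) [NeZero d], ObeysAdaptiveLimit (erasure d)) ∧
    -- Choi matrix of the generalized Pauli channel, in orthogonal Bell projectors
    (∀ (d : ℕ) [NeZero d],
      (∀ p : ZMod d × ZMod d → ℝ,
        choi (pauliChannel d p) = ∑ k, (p k : ℂ) • bellProjector d k) ∧
      (∀ k l : ZMod d × ZMod d,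
        bellProjector d k * bellProjector d l = if k = l then bellProjector d k else 0)) ∧
    -- fidelity of the Choi matrices of two generalized Pauli channels
    (∀ (d : ℕ) [NeZero d] (p q : ZMod d × ZMod d → ℝ),
      (∀ k, 0 ≤ p k) → ∑ k, p k = 1 → (∀ k, 0 ≤ q k) → ∑ k, q k = 1 →
      fidelity (choi (pauliChannel d p)) (choi (pauliChannel d q)) = ∑ k, √(p k * q k)) ∧
    -- its expansion for neighbouring distributions with the same support
    (∀ (d : ℕ) [NeZero d] (p : ZMod d × ZMod d → ℝ), (∀ k, 0 ≤ p k) → ∑ k, p k = 1 →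
      (fun δ : ZMod d × ZMod d → ℝ =>
        fidelity (choi (pauliChannel d p)) (choi (pauliChannel d (p + δ))) -
          (1 - 1 / 8 * ∑ k, δ k ^ 2 / p k))
        =o[𝓝[{δ | ∑ k, δ k = 0 ∧ ∀ k, p k = 0 → δ k = 0}] 0] fun δ => ‖δ‖ ^ 2) ∧
    -- Choi matrix and fidelity of erasure channels
    (∀ (d : ℕ) [NeZero d],
      (∀ π : ℝ, choi (erasure d π) =
        ((1 - π : ℝ) : ℂ) • conjMap ((1 : Op (ZMod d)) ⊗ₖ embedOp d) (bell (ZMod d)) +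
          (π : ℂ) • (((d : ℂ)⁻¹ • (1 : Op (ZMod d))) ⊗ₖ erasureState d)) ∧
      (∀ π ∈ Set.Icc (0 : ℝ) 1, ∀ π' ∈ Set.Icc (0 : ℝ) 1,
        fidelity (choi (erasure d π)) (choi (erasure d π')) =
          √((1 - π) * (1 - π')) + √(π * π'))) :=
  ⟨obeysAdaptiveLimit_depolarizing, obeysAdaptiveLimit_dephasing,
    fun d _ => (haveOrthogonalChoi_erasure d).obeysAdaptiveLimit (erasure_eq d),
    fun d _ => ⟨choi_pauliChannel d, bellProjector_mul d⟩,
    fun d _ _ _ hp _ hq _ => fidelity_choi_pauliChannel d hp hq,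
    fun d _ _ hp hp1 => fidelity_choi_pauliChannel_expansion d hp hp1,
    fun d _ => ⟨choi_erasure d, fun _ hp _ hq =>
      (haveOrthogonalChoi_erasure d).fidelity_choi hp hq⟩⟩
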